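/- Let $m$ be Lebesgue measure on $[0,1]$, and let $BV$ be the space of $f\in L^1(m)$ with $V(f)=\inf\{\operatorname{var}\bar f:\bar f=f\ m\text{-a.e.}\}<\infty$, where $\operatorname{var}\bar f$ is the total variation of $\bar f$ on $[0,1]$, with norm $\|f\|_{BV}=V(f)+\|f\|_{L^1(m)}$. For a measurable map $T:[0,1]\to[0,1]$ with $T_*m\ll m$, let $P_T$ be its transfer operator on $L^1(m)$, i.e. $\int (P_Tf)\,g\,dm=\int f\cdot (g\circ T)\,dm$ for $f\in L^1(m)$, $g\in L^\infty(m)$. Let $\mathcal C$ be a class of measurable maps $T:[0,1]\to[0,1]$ with the following properties. (1) There are an integer $r\ge 1$ and constants $0<\rho<1$, $M_0,C_r>0$ such that for all $f\in BV$, $\|P_Tf\|_{BV}\le M_0\|f\|_{BV}$ for all $T\in\mathcal C$, and $\|P_{T_r}\cdots P_{T_1}f\|_{BV}\le \rho\|f\|_{BV}+C_r\|f\|_{L^1(m)}$ for all $T_1,\dots,T_r\in\mathcal C$. (2) There are $0\le\theta<1$ and $K>0$ such that $\|P_{T_l}\cdots P_{T_1}f\|_{BV}\le K\theta^l\|f\|_{BV}$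 for all $l\ge1$, all $T_1,\dots,T_l\in\mathcal C$ and all $f\in BV$ with $\int f\,dm=0$. (3) There are $\lambda>1$, $M\ge1$ and $N\ge1$ such that for each $T\in\mathcal C$ there are $k\le N$ and points $0=a_0<\dots<a_k=1$ such that, for each $i<k$, $T$ coincides on $(a_i,a_{i+1})$ with a map of class $C^2$ on a neighbourhood of $[a_i,a_{i+1}]$, and $|T'|\ge\lambda$ and $|T''|\le M$ on $(a_i,a_{i+1})$. Let $(T_n)_{n\ge1}$ be a sequence in $\mathcal C$, put $T_1^0=\mathrm{id}$ and $T_1^k=T_k\circ\cdots\circ T_1$, and suppose that there is $\delta>0$ with $P_{T_1^n}\mathbf 1\ge\delta$ $m$-a.e. for all $n\ge1$. Then there exist constants $C_1,C_2>0$ such that for every measurable $A\subseteq[0,1]$ with $m(A)>0$, every $n\ge1$ and every $t>0$, the function $$Z_n(x)=\inf_{y\in A}\frac1n\sum_{k=0}^{n-1}|T_1^kx-T_1^ky|$$ satisfies $$m\left(Z_n>C_1\frac{\sqrt{|\log m(A)|}}{\sqrt n}+\frac t{\sqrt n}\right)\le e^{-C_2t^2}.$$ -/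

import Mathlib

open MeasureTheory Set
open scoped ENNReal NNReal

namespace SeqDyn

noncomputable section

/-- Lebesgue measure `m` on the unit interval `[0,1]`, as a measure on `ℝ`.
Maps of `[0,1]` are represented by functions `ℝ → ℝ` mapping `[0,1]` to itself; their values
outside `[0,1]` play no role. -/
def leb01 : Measure ℝ := volume.restrict (Icc 0 1)

/-- The composition `T_1^n = T_n ∘ ... ∘ T_1` (with `T_1^0 = id`) of a sequence `(T_n)_{n ≥ 1}`;
the entry `T 0` is never used. -/
def seqIter (T : ℕ → ℝ → ℝ) : ℕ → ℝ → ℝ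
  | 0 => id
  | n + 1 => T (n + 1) ∘ seqIter T n

/-- The transfer operator `P_T` on `L¹(m)`: `P_T f` is the density with respect to `m` of the
push-forward under `T` of the signed measure `f m`. For measurable non-singular `T` and `f ∈ L¹(m)`
it is the `m`-a.e. unique integrable function with `∫ (P_T f) g dm = ∫ f (g ∘ T) dm` for all
bounded measurable `g`. -/
def transferOp (T : ℝ → ℝ) (f : ℝ → ℝ) : ℝ → ℝ :=
  SignedMeasure.rnDeriv ((leb01.withDensityᵥ f).map T) leb01

/-- The composition `P_{T_n} ... P_{T_1}` of transfer operators. -/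
def transferSeq (T : ℕ → ℝ → ℝ) : ℕ → (ℝ → ℝ) → (ℝ → ℝ)
  | 0, f => f
  | n + 1, f => transferOp (T (n + 1)) (transferSeq T n f)

/-- The variation `V f = inf {var f' : f' = f m-a.e.}` of the `m`-class of `f` on `[0,1]`. -/
def essVar (f : ℝ → ℝ) : ℝ≥0∞ :=
  ⨅ (g : ℝ → ℝ) (_ : g =ᵐ[leb01] f), eVariationOn g (Icc 0 1)

/-- The `BV` norm `V f + ‖f‖_{L¹(m)}`, with values in `[0,∞]`. -/
def bvNorm (f : ℝ → ℝ) : ℝ≥0∞ := essVar f + eLpNorm f 1 leb01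

/-- Membership in `BV`: `f ∈ L¹(m)` and `V f < ∞`. -/
def IsBV (f : ℝ → ℝ) : Prop := Integrable f leb01 ∧ essVar f < ∞

/-- `T : [0,1] → [0,1]` is measurable and `C²` on each piece of the finite partition of `[0,1]`
given by the points `0 = a 0 < a 1 < ... < a k = 1`: on each interval `(a i, a (i+1))` it coincides
with a map that is `C²` on a neighbourhood of `[a i, a (i+1)]`. -/
structure IsPiecewiseC2 (T : ℝ → ℝ) (k : ℕ) (a : Fin (k + 1) → ℝ) : Prop where
  measurable : Measurable T
  mapsTo : MapsTo T (Icc 0 1) (Icc 0 1)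
  strictMono : StrictMono a
  first : a 0 = 0
  last : a (Fin.last k) = 1
  extends_C2 : ∀ i : Fin k, ∃ (U : Set ℝ) (S : ℝ → ℝ), IsOpen U ∧
    Icc (a i.castSucc) (a i.succ) ⊆ U ∧ ContDiffOn ℝ 2 S U ∧
    EqOn T S (Ioo (a i.castSucc) (a i.succ))

/-- Condition `(D_r)`: the transfer operators of the maps of the class `C` are uniformly bounded on
`BV`, and all compositions of `r` of them satisfy a uniform Lasota-Yorke inequality. -/
def ConditionD (C : Set (ℝ → ℝ)) (r : ℕ) : Prop :=
  ∃ ρ M₀ Cr : ℝ≥0, 0 < ρ ∧ ρ < 1 ∧ 0 < M₀ ∧ 0 < Cr ∧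
    (∀ T ∈ C, ∀ f, IsBV f → bvNorm (transferOp T f) ≤ M₀ * bvNorm f) ∧
    (∀ T : ℕ → ℝ → ℝ, (∀ j, 1 ≤ j → T j ∈ C) → ∀ f, IsBV f →
      bvNorm (transferSeq T r f) ≤ ρ * bvNorm f + Cr * eLpNorm f 1 leb01)

/-- The decorrelation property (Dec) of the class `C`: uniform exponential decay in `BV` norm of
compositions of transfer operators on `BV` functions with zero average. -/
def ConditionDec (C : Set (ℝ → ℝ)) : Prop :=
  ∃ θ K : ℝ≥0, θ < 1 ∧ 0 < K ∧
    ∀ l : ℕ, 1 ≤ l → ∀ T : ℕ → ℝ → ℝ, (∀ j, 1 ≤ j → T j ∈ C) →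
      ∀ f, IsBV f → ∫ x, f x ∂leb01 = 0 →
        bvNorm (transferSeq T l f) ≤ K * θ ^ l * bvNorm f

/-- The standing assumptions on a class `C` of piecewise expanding maps of `[0,1]`. -/
structure IsAdmissibleClass (C : Set (ℝ → ℝ)) : Prop where
  condD : ∃ r : ℕ, 1 ≤ r ∧ ConditionD C r
  condDec : ConditionDec C
  /-- Uniform bounds on the number of branches, the expansion and the second derivative. -/
  uniform : ∃ (lam M : ℝ) (N : ℕ), 1 < lam ∧ 1 ≤ M ∧ 1 ≤ N ∧
    ∀ T ∈ C, ∃ (k : ℕ) (a : Fin (k + 1) → ℝ), k ≤ N ∧ IsPiecewiseC2 T k a ∧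
      ∀ i : Fin k, ∀ x ∈ Ioo (a i.castSucc) (a i.succ),
        lam ≤ |deriv T x| ∧ |deriv (deriv T) x| ≤ M

/-- The minoration condition (Min) on the sequence `(T_n)_{n ≥ 1}`: there is `δ > 0` with
`P_1^n 1 ≥ δ` for all `n`. -/
def ConditionMin (T : ℕ → ℝ → ℝ) : Prop :=
  ∃ δ : ℝ, 0 < δ ∧ ∀ n : ℕ, 1 ≤ n →
    ∀ᵐ x ∂leb01, δ ≤ transferOp (seqIter T n) (fun _ => 1) x

/-- `Z_n(x) = inf_{y ∈ A} (1/n) ∑_{k < n} |T_1^k x - T_1^k y|`. -/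
def shadow (T : ℕ → ℝ → ℝ) (A : Set ℝ) (n : ℕ) (x : ℝ) : ℝ :=
  ⨅ y : A, (1 / (n : ℝ)) * ∑ k ∈ Finset.range n, |seqIter T k x - seqIter T k y|

end

end SeqDyn

namespace SeqDyn

/-! The function `Z_n` is a functional of the orbit with Lipschitz constant `1/n` in each of the
first `n` coordinates, and such functionals satisfy a Hoeffding-type bound on exponential moments,
proved with reverse martingale differences.

Let `𝓑 p` be the σ-algebra generated by `T_1^p`; it decreases with `p`. If the conditional
expectations `X p` of `Z_n` given `𝓑 p` satisfy `|X p - X (p+1)| ≤ D/n`, then `n` steps from `X 0 =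
Z_n` to `X n`, and one more to the mean, give `∫ exp (s Z_n) ≤ exp (s² D² / n + s ∫ Z_n)`
(`HasDecay.integral_exp_orbit_le`). The functional vanishes on `A`, so for negative exponents the
left side is at least `m(A)`; optimising in `s` bounds the mean by a multiple of `√|log m(A)| / √n`,
and Chernoff's bound controls the deviation above the mean.

To bound the differences, `X p` is compared with `tailMean`: keep the future that starts at `T_1^p
x` and average over an independent past. Consecutive such means differ in one coordinate only, hence
by at most `1/n`. That conditioning on the future almost amounts to an independent past
(`HasDecay.abs_setIntegral_orbit_sub_tailMean_le`) is decay of correlations. With the future frozen,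
the past coordinates are switched on one at a time. The increment at time `i` has size `O(1/n)` and,
along a branch of `T_1^i`, is `O(1/n)`-Lipschitz in `T_1^i x`, because distances at earlier times
are geometrically smaller. Its centred image under the transfer operators up to time `i` therefore
has `BV` norm `O(1/n)`; decorrelation shrinks this by `θ^(p-i)`, `BV` controls the supremum, and the
minoration `δ` turns a bound by `m(B)` into one by `m((T_1^p)⁻¹ B)`. The errors sum to `O(1/n)`.

The `BV` bound must be uniform in `i`. It reduces to bounding `∑ sup 1/|(T_1^i)'|` over branches
(`exists_branchFamily`), which follows from expansion, bounded distortion, the bounded number of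
cutting points and a uniform upper bound on `P_{T_i} ⋯ P_{T_1} 1`. -/

instance : IsProbabilityMeasure leb01 := by
  constructor
  simp [leb01]

theorem ae_mem_Icc : ∀ᵐ x ∂leb01, x ∈ Icc (0 : ℝ) 1 :=
  ae_restrict_mem measurableSet_Icc

/-! ### Duality for transfer operators -/

theorem integrable_transferOp (T f : ℝ → ℝ) : Integrable (transferOp T f) leb01 :=
  SignedMeasure.integrable_rnDeriv _ _

/-- Nonsingularity makes the push-forward absolutely continuous, so it has no singular part and its
Radon-Nikodym derivative recovers it entirely. -/
theorem setIntegral_transferOp {T f : ℝ → ℝ} (hT : Measure.QuasiMeasurePreserving T leb01 leb01)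
    (hf : Integrable f leb01) {B : Set ℝ} (hB : MeasurableSet B) :
    ∫ x in B, transferOp T f x ∂leb01 = ∫ x in T ⁻¹' B, f x ∂leb01 := by
  have hac : (leb01.withDensityᵥ f).map T ≪ᵥ leb01.toENNRealVectorMeasure := by
    refine VectorMeasure.AbsolutelyContinuous.mk fun s hs h0 => ?_
    rw [Measure.toENNRealVectorMeasure_apply_measurable hs] at h0
    rw [VectorMeasure.map_apply _ hT.measurable hs,
      withDensityᵥ_apply hf (hT.measurable hs)]
    exact setIntegral_measure_zero _ (hT.preimage_null h0)
  have h := SignedMeasure.withDensityᵥ_rnDeriv_eq _ _ hac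
  have h' : leb01.withDensityᵥ (transferOp T f) B = (leb01.withDensityᵥ f).map T B := by
    rw [← h]; rfl

  rw [withDensityᵥ_apply (integrable_transferOp T f) hB,
    VectorMeasure.map_apply _ hT.measurable hB, withDensityᵥ_apply hf (hT.measurable hB)] at h'
  exact h'

theorem quasiMeasurePreserving_seqIter {T : ℕ → ℝ → ℝ}
    (hT : ∀ j, 1 ≤ j → Measure.QuasiMeasurePreserving (T j) leb01 leb01) (n : ℕ) :
    Measure.QuasiMeasurePreserving (seqIter T n) leb01 leb01 := by
  induction n with
  | zero => exact Measure.QuasiMeasurePreserving.id _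
  | succ n ih => exact (hT (n + 1) (by omega)).comp ih

theorem integrable_transferSeq (T : ℕ → ℝ → ℝ) {f : ℝ → ℝ} (hf : Integrable f leb01) (n : ℕ) :
    Integrable (transferSeq T n f) leb01 := by
  cases n with
  | zero => exact hf
  | succ n => exact integrable_transferOp _ _

theorem setIntegral_transferSeq {T : ℕ → ℝ → ℝ}
    (hT : ∀ j, 1 ≤ j → Measure.QuasiMeasurePreserving (T j) leb01 leb01) {f : ℝ → ℝ}
    (hf : Integrable f leb01) (n : ℕ) {B : Set ℝ} (hB : MeasurableSet B) :
    ∫ x in B, transferSeq T n f x ∂leb01 = ∫ x in seqIter T n ⁻¹' B, f x ∂leb01 := by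
  induction n generalizing B with
  | zero => rfl
  | succ n ih =>
    rw [transferSeq, setIntegral_transferOp (hT (n + 1) (by omega))
      (integrable_transferSeq T hf n) hB, ih ((hT (n + 1) (by omega)).measurable hB)]
    rfl

theorem integral_transferSeq {T : ℕ → ℝ → ℝ}
    (hT : ∀ j, 1 ≤ j → Measure.QuasiMeasurePreserving (T j) leb01 leb01) {f : ℝ → ℝ}
    (hf : Integrable f leb01) (n : ℕ) :
    ∫ x, transferSeq T n f x ∂leb01 = ∫ x, f x ∂leb01 := by
  simpa using setIntegral_transferSeq hT hf n MeasurableSet.univ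

theorem transferSeq_ae_eq {T : ℕ → ℝ → ℝ}
    (hT : ∀ j, 1 ≤ j → Measure.QuasiMeasurePreserving (T j) leb01 leb01) {f h : ℝ → ℝ}
    (hf : Integrable f leb01) (hh : Integrable h leb01) (n : ℕ)
    (H : ∀ B, MeasurableSet B → ∫ x in B, h x ∂leb01 = ∫ x in seqIter T n ⁻¹' B, f x ∂leb01) :
    transferSeq T n f =ᵐ[leb01] h :=
  Integrable.ae_eq_of_forall_setIntegral_eq _ _ (integrable_transferSeq T hf n) hh
    fun B hB _ => by rw [setIntegral_transferSeq hT hf n hB, H B hB]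

theorem transferSeq_add (T : ℕ → ℝ → ℝ) (i l : ℕ) (f : ℝ → ℝ) :
    transferSeq T (i + l) f = transferSeq (fun j => T (j + i)) l (transferSeq T i f) := by
  induction l with
  | zero => rfl
  | succ l ih =>
    rw [← add_assoc, transferSeq, transferSeq, ih]
    congr 2
    omega

theorem transferSeq_sub_ae_eq {T : ℕ → ℝ → ℝ}
    (hT : ∀ j, 1 ≤ j → Measure.QuasiMeasurePreserving (T j) leb01 leb01) {f g : ℝ → ℝ}
    (hf : Integrable f leb01) (hg : Integrable g leb01) (n : ℕ) :
    transferSeq T n (fun x => f x - g x) =ᵐ[leb01]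
      fun x => transferSeq T n f x - transferSeq T n g x := by
  refine transferSeq_ae_eq (h := fun x => transferSeq T n f x - transferSeq T n g x) hT
    (f := fun x => f x - g x) (hf.sub hg)
    ((integrable_transferSeq T hf n).sub (integrable_transferSeq T hg n)) n fun B hB => ?_
  rw [integral_sub (integrable_transferSeq T hf n).integrableOn
    (integrable_transferSeq T hg n).integrableOn, integral_sub hf.integrableOn hg.integrableOn,
    setIntegral_transferSeq hT hf n hB, setIntegral_transferSeq hT hg n hB]

/-! ### The `BV` norm -/

theorem essVar_le {f g : ℝ → ℝ} (h : g =ᵐ[leb01] f) : essVar f ≤ eVariationOn g (Icc 0 1) :=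
  iInf₂_le g h

theorem essVar_sub_const_le (f : ℝ → ℝ) (c : ℝ) : essVar (fun x => f x - c) ≤ essVar f := by
  refine le_iInf₂ fun g hg => ?_
  refine (essVar_le (g := fun x => g x - c) ?_).trans (le_of_eq ?_)
  · filter_upwards [hg] with x hx
    rw [hx]
  · unfold eVariationOn
    simp

/-- A representative `g` with almost minimal variation satisfies `|g x| ≤ var g + |g y|`; integrate
in `y` against the probability measure. The slack `ε` is then removed along a countable sequence, so
that the exceptional set stays null. -/
theorem ae_enorm_le_bvNorm (f : ℝ → ℝ) :
    ∀ᵐ x ∂leb01, ‖f x‖ₑ ≤ bvNorm f := by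
  by_cases htop : essVar f = ∞
  · filter_upwards with x
    simp [bvNorm, htop]
  have key : ∀ ε : ℝ≥0, 0 < ε → ∀ᵐ x ∂leb01, ‖f x‖ₑ ≤ bvNorm f + ε := by
    intro ε hε
    have hlt : essVar f < essVar f + ε :=
      ENNReal.lt_add_right htop (by exact_mod_cast hε.ne')
    obtain ⟨g, hgf, hg⟩ := by
      simpa [essVar, iInf_lt_iff] using hlt
    filter_upwards [hgf, ae_mem_Icc] with x hx hx01
    have h1 : ∀ y ∈ Icc (0 : ℝ) 1, ‖g x‖ₑ ≤ eVariationOn g (Icc 0 1) + ‖g y‖ₑ := by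
      intro y hy
      have := eVariationOn.edist_le g hx01 hy
      calc ‖g x‖ₑ = ‖(g x - g y) + g y‖ₑ := by simp
        _ ≤ ‖g x - g y‖ₑ + ‖g y‖ₑ := enorm_add_le _ _
        _ ≤ _ := by rw [← edist_eq_enorm_sub]; gcongr
    have h2 : ∫⁻ y, ‖g x‖ₑ ∂leb01 ≤ ∫⁻ y, (eVariationOn g (Icc 0 1) + ‖f y‖ₑ) ∂leb01 := by
      refine lintegral_mono_ae ?_
      filter_upwards [hgf, ae_mem_Icc] with y hy hy01
      rw [← hy]
      exact h1 y hy01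
    rw [lintegral_add_left measurable_const] at h2
    simp only [lintegral_const, measure_univ, mul_one] at h2
    rw [← hx, bvNorm, eLpNorm_one_eq_lintegral_enorm]
    refine h2.trans ?_
    rw [add_right_comm]
    gcongr
    exact hg.le
  have h3 : ∀ᵐ x ∂leb01, ∀ n : ℕ, ‖f x‖ₑ ≤ bvNorm f + ((1 / ((n : ℝ≥0) + 1) : ℝ≥0) : ℝ≥0∞) :=
    ae_all_iff.2 fun n => key _ (by positivity)
  filter_upwards [h3] with x hx
  have hlim : Filter.Tendsto (fun n : ℕ => bvNorm f + ((1 / ((n : ℝ≥0) + 1) : ℝ≥0) : ℝ≥0∞))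
      Filter.atTop (nhds (bvNorm f + ((0 : ℝ≥0) : ℝ≥0∞))) := by
    refine Filter.Tendsto.const_add _ ?_
    exact ENNReal.tendsto_coe.2 tendsto_one_div_add_atTop_nhds_zero_nat
  simpa using ge_of_tendsto' hlim hx

/-! ### Expanding branches -/

/-- `T` is differentiable and expanding with bounded distortion on the open interval `J`. -/
structure ExpandingOn (T : ℝ → ℝ) (lam M : ℝ) (J : Set ℝ) : Prop where
  isOpen : IsOpen J
  ordConnected : J.OrdConnected
  differentiableAt : ∀ x ∈ J, DifferentiableAt ℝ T x
  le_abs_deriv : ∀ x ∈ J, lam ≤ |deriv T x|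
  expand : ∀ x ∈ J, ∀ y ∈ J, lam * |x - y| ≤ |T x - T y|
  distort : ∀ x ∈ J, ∀ y ∈ J, |deriv T x| ≤ |deriv T y| * Real.exp (M * |x - y|)

theorem mul_abs_sub_le_of_le_abs_deriv {T : ℝ → ℝ} {lam : ℝ} {J : Set ℝ} (hJ : J.OrdConnected)
    (hd : ∀ x ∈ J, DifferentiableAt ℝ T x) (hl : ∀ x ∈ J, lam ≤ |deriv T x|)
    {x y : ℝ} (hx : x ∈ J) (hy : y ∈ J) : lam * |x - y| ≤ |T x - T y| := by
  wlog hxy : x < y generalizing x y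
  · rcases eq_or_lt_of_le (not_lt.1 hxy) with rfl | h
    · simp
    · rw [abs_sub_comm x, abs_sub_comm (T x)]
      exact this hy hx h
  have hsub : Icc x y ⊆ J := hJ.out hx hy
  obtain ⟨z, hz, h⟩ := exists_deriv_eq_slope T hxy
    (fun w hw => (hd w (hsub hw)).continuousAt.continuousWithinAt)
    (fun w hw => (hd w (hsub (Ioo_subset_Icc_self hw))).differentiableWithinAt)
  have h1 := hl z (hsub (Ioo_subset_Icc_self hz))
  rw [h, abs_div, le_div_iff₀ (abs_pos.2 (sub_pos.2 hxy).ne')] at h1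
  rwa [abs_sub_comm x, abs_sub_comm (T x)]

theorem IsPiecewiseC2.expandingOn {T : ℝ → ℝ} {k : ℕ} {a : Fin (k + 1) → ℝ}
    (h : IsPiecewiseC2 T k a) {lam M : ℝ} (hlam : 1 ≤ lam) (i : Fin k)
    (hb : ∀ x ∈ Ioo (a i.castSucc) (a i.succ), lam ≤ |deriv T x| ∧ |deriv (deriv T) x| ≤ M) :
    ExpandingOn T lam M (Ioo (a i.castSucc) (a i.succ)) := by
  set J := Ioo (a i.castSucc) (a i.succ) with hJ
  obtain ⟨U, S, -, hsub, hS, hTS⟩ := h.extends_C2 i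
  have hT : ContDiffOn ℝ 2 T J := (hS.mono (Ioo_subset_Icc_self.trans hsub)).congr hTS
  have hd : ∀ x ∈ J, DifferentiableAt ℝ T x := fun x hx =>
    (hT.contDiffAt (isOpen_Ioo.mem_nhds hx)).differentiableAt (by norm_num)
  have hT' : ContDiffOn ℝ 1 (deriv T) J := hT.deriv_of_isOpen isOpen_Ioo (by norm_num)
  have hd' : ∀ x ∈ J, DifferentiableAt ℝ (deriv T) x := fun x hx =>
    (hT'.contDiffAt (isOpen_Ioo.mem_nhds hx)).differentiableAt (by norm_num)
  refine ⟨isOpen_Ioo, ordConnected_Ioo, hd, fun x hx => (hb x hx).1, fun x hx y hy =>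
    mul_abs_sub_le_of_le_abs_deriv ordConnected_Ioo hd (fun z hz => (hb z hz).1) hx hy, ?_⟩
  -- The mean value bound for `T'` gives `|T' x| ≤ |T' y| + M |x - y|`. Since `|T' y| ≥ 1`, this is
  -- at most `|T' y| (1 + M |x - y|)`.
  intro x hx y hy
  have h1 := Convex.norm_image_sub_le_of_norm_deriv_le (f := deriv T) hd'
    (fun z hz => (hb z hz).2) (convex_Ioo _ _) hy hx
  rw [Real.norm_eq_abs, Real.norm_eq_abs] at h1
  have h2 : |deriv T x| ≤ |deriv T y| + M * |x - y| := by
    have := abs_sub_abs_le_abs_sub (deriv T x) (deriv T y)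
    linarith
  have h3 : M * |x - y| + 1 ≤ Real.exp (M * |x - y|) := Real.add_one_le_exp _
  have h4 : 1 ≤ |deriv T y| := hlam.trans (hb y hy).1
  have h5 : 0 ≤ M * |x - y| :=
    mul_nonneg ((abs_nonneg _).trans (hb y hy).2) (abs_nonneg _)
  nlinarith

/-- `I` is an interval of monotonicity of the composition `T_1^i`, on which the composition is
expanding with distortion constant `c`. -/
structure BranchOn (T : ℕ → ℝ → ℝ) (lam c : ℝ) (i : ℕ) (I : Set ℝ) : Prop where
  isOpen : IsOpen I
  ordConnected : I.OrdConnected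
  subset : I ⊆ Ioo 0 1
  differentiableAt : ∀ x ∈ I, DifferentiableAt ℝ (seqIter T i) x
  one_le_abs_deriv : ∀ x ∈ I, 1 ≤ |deriv (seqIter T i) x|
  expand : ∀ x ∈ I, ∀ y ∈ I, ∀ j < i,
    lam * |seqIter T j x - seqIter T j y| ≤ |seqIter T (j + 1) x - seqIter T (j + 1) y|
  distort : ∀ x ∈ I, ∀ y ∈ I, |deriv (seqIter T i) x| ≤
    |deriv (seqIter T i) y| * Real.exp (c * |seqIter T i x - seqIter T i y|)

namespace BranchOn

variable {T : ℕ → ℝ → ℝ} {lam c : ℝ} {i : ℕ} {I : Set ℝ}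

theorem zero (T : ℕ → ℝ → ℝ) (lam : ℝ) {c : ℝ} (hc : 0 ≤ c) : BranchOn T lam c 0 (Ioo 0 1) where
  isOpen := isOpen_Ioo
  ordConnected := ordConnected_Ioo
  subset := Subset.rfl
  differentiableAt x _ := differentiableAt_id
  one_le_abs_deriv x _ := by simp [seqIter]
  expand x _ y _ j hj := by omega
  distort x _ y _ := by
    simp only [seqIter, deriv_id, abs_one, one_mul]
    exact Real.one_le_exp (by positivity)

theorem continuousOn (h : BranchOn T lam c i I) : ContinuousOn (seqIter T i) I :=
  fun x hx => (h.differentiableAt x hx).continuousAt.continuousWithinAt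

theorem pow_mul_le (h : BranchOn T lam c i I) (hlam : 0 ≤ lam) {x y : ℝ} (hx : x ∈ I)
    (hy : y ∈ I) {l j : ℕ} (hj : j + l = i) :
    lam ^ l * |seqIter T j x - seqIter T j y| ≤ |seqIter T i x - seqIter T i y| := by
  induction l generalizing j with
  | zero => simp_all
  | succ l ih =>
    refine le_trans ?_ (ih (j := j + 1) (by omega))
    rw [pow_succ, mul_assoc]
    gcongr
    exact h.expand x hx y hy j (by omega)

theorem abs_sub_le (h : BranchOn T lam c i I) (hlam : 1 ≤ lam) {x y : ℝ} (hx : x ∈ I)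
    (hy : y ∈ I) : |x - y| ≤ |seqIter T i x - seqIter T i y| := by
  refine le_trans ?_ (h.pow_mul_le (by linarith) hx hy (zero_add i))
  exact le_mul_of_one_le_left (abs_nonneg _) (one_le_pow₀ hlam)

theorem injOn (h : BranchOn T lam c i I) (hlam : 1 ≤ lam) : InjOn (seqIter T i) I := by
  intro x hx y hy hxy
  have := h.abs_sub_le hlam hx hy
  rw [hxy, sub_self, abs_zero] at this
  exact sub_eq_zero.1 (abs_nonpos_iff.1 this)

theorem strictMonoOn_or_strictAntiOn (h : BranchOn T lam c i I) (hlam : 1 ≤ lam) {x y : ℝ}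
    (hx : x ∈ I) (hy : y ∈ I) (hxy : x ≤ y) :
    StrictMonoOn (seqIter T i) (Icc x y) ∨ StrictAntiOn (seqIter T i) (Icc x y) :=
  ContinuousOn.strictMonoOn_of_injOn_Icc' hxy (h.continuousOn.mono (h.ordConnected.out hx hy))
    ((h.injOn hlam).mono (h.ordConnected.out hx hy))

theorem ordConnected_image (h : BranchOn T lam c i I) : (seqIter T i '' I).OrdConnected :=
  (h.ordConnected.isPreconnected.image _ h.continuousOn).ordConnected

/-- The branch is strictly monotone near `x`, so the image of a small interval around `x` extends to
both sides of the image of `x`. -/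
theorem image_mem_nhds (h : BranchOn T lam c i I) (hlam : 1 ≤ lam) {x : ℝ} (hx : x ∈ I) :
    seqIter T i '' I ∈ nhds (seqIter T i x) := by
  obtain ⟨ε, hε, hball⟩ := Metric.isOpen_iff.1 h.isOpen x hx
  have h1 : x - ε / 2 ∈ I := hball (by
    rw [Metric.mem_ball, Real.dist_eq, sub_sub_cancel_left, abs_neg, abs_of_pos] <;> linarith)
  have h2 : x + ε / 2 ∈ I := hball (by
    rw [Metric.mem_ball, Real.dist_eq, add_sub_cancel_left, abs_of_pos] <;> linarith)
  have m1 : x - ε / 2 ∈ Icc (x - ε / 2) (x + ε / 2) := ⟨le_rfl, by linarith⟩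
  have m2 : x + ε / 2 ∈ Icc (x - ε / 2) (x + ε / 2) := ⟨by linarith, le_rfl⟩
  have m : x ∈ Icc (x - ε / 2) (x + ε / 2) := ⟨by linarith, by linarith⟩
  rcases h.strictMonoOn_or_strictAntiOn hlam h1 h2 (by linarith) with hm | hm
  · exact Filter.mem_of_superset (Icc_mem_nhds (hm m1 m (by linarith)) (hm m m2 (by linarith)))
      (h.ordConnected_image.out (mem_image_of_mem _ h1) (mem_image_of_mem _ h2))
  · exact Filter.mem_of_superset (Icc_mem_nhds (hm m m2 (by linarith)) (hm m1 m (by linarith)))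
      (h.ordConnected_image.out (mem_image_of_mem _ h2) (mem_image_of_mem _ h1))

theorem deriv_succ {J : Set ℝ} {M : ℝ} (h : BranchOn T lam c i I)
    (hJ : ExpandingOn (T (i + 1)) lam M J) {x : ℝ} (hx : x ∈ I) (hxJ : seqIter T i x ∈ J) :
    deriv (seqIter T (i + 1)) x = deriv (T (i + 1)) (seqIter T i x) * deriv (seqIter T i) x :=
  deriv_comp x (hJ.differentiableAt _ hxJ) (h.differentiableAt x hx)

/-- Distortion is measured by the distance `d` of the images, which makes a single `c` work for all
times: one more map costs `M d`, while expansion replaces `c d` by at least `c lam d` on the right,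
and `c + M ≤ lam * c`. -/
theorem succ {J : Set ℝ} {M : ℝ} (h : BranchOn T lam c i I)
    (hJ : ExpandingOn (T (i + 1)) lam M J) (hlam : 1 ≤ lam) (hc0 : 0 ≤ c)
    (hc : c + M ≤ lam * c) :
    BranchOn T lam c (i + 1) (I ∩ seqIter T i ⁻¹' J) := by
  have hexp : ∀ x ∈ I ∩ seqIter T i ⁻¹' J, ∀ y ∈ I ∩ seqIter T i ⁻¹' J, ∀ j < i + 1,
      lam * |seqIter T j x - seqIter T j y| ≤ |seqIter T (j + 1) x - seqIter T (j + 1) y| := by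
    intro x hx y hy j hj
    rcases Nat.lt_succ_iff_lt_or_eq.1 hj with hj | rfl
    · exact h.expand x hx.1 y hy.1 j hj
    · exact hJ.expand _ hx.2 _ hy.2
  refine ⟨h.continuousOn.isOpen_inter_preimage h.isOpen hJ.isOpen, ?_,
    inter_subset_left.trans h.subset, fun x hx =>
      (hJ.differentiableAt _ hx.2).comp x (h.differentiableAt x hx.1), ?_, hexp, ?_⟩
  · refine ⟨fun x hx z hz y hy => ⟨h.ordConnected.out hx.1 hz.1 hy, ?_⟩⟩
    have hxz := hy.1.trans hy.2
    have mx : x ∈ Icc x z := ⟨le_rfl, hxz⟩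
    have mz : z ∈ Icc x z := ⟨hxz, le_rfl⟩
    rcases h.strictMonoOn_or_strictAntiOn hlam hx.1 hz.1 hxz with hm | hm
    · exact hJ.ordConnected.out hx.2 hz.2 ⟨hm.monotoneOn mx hy hy.1, hm.monotoneOn hy mz hy.2⟩
    · exact hJ.ordConnected.out hz.2 hx.2 ⟨hm.antitoneOn hy mz hy.2, hm.antitoneOn mx hy hy.1⟩
  · intro x hx
    rw [h.deriv_succ hJ hx.1 hx.2, abs_mul]
    exact one_le_mul_of_one_le_of_one_le (hlam.trans (hJ.le_abs_deriv _ hx.2))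
      (h.one_le_abs_deriv x hx.1)
  · intro x hx y hy
    rw [h.deriv_succ hJ hx.1 hx.2, h.deriv_succ hJ hy.1 hy.2, abs_mul, abs_mul]
    have h1 := h.distort x hx.1 y hy.1
    have h2 := hJ.distort _ hx.2 _ hy.2
    have h3 := hexp x hx y hy i (by omega)
    have h4 : M * |seqIter T i x - seqIter T i y| + c * |seqIter T i x - seqIter T i y| ≤
        c * |seqIter T (i + 1) x - seqIter T (i + 1) y| := by
      have := mul_le_mul_of_nonneg_left h3 hc0
      have := mul_le_mul_of_nonneg_right hc (abs_nonneg (seqIter T i x - seqIter T i y))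
      nlinarith
    calc _ ≤ (|deriv (T (i + 1)) (seqIter T i y)| * Real.exp (M * |seqIter T i x - seqIter T i y|))
          * (|deriv (seqIter T i) y| * Real.exp (c * |seqIter T i x - seqIter T i y|)) := by
          gcongr
      _ = |deriv (T (i + 1)) (seqIter T i y)| * |deriv (seqIter T i) y| *
          Real.exp (M * |seqIter T i x - seqIter T i y| + c * |seqIter T i x - seqIter T i y|) := by
          rw [Real.exp_add]; ring
      _ ≤ _ := by gcongr

end BranchOn

/-! ### Branch formula for the transfer operator -/

/-- The contribution of the branch of `S` on `I` to the transfer operator of `S` applied to `w`. -/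
noncomputable def branchDensity (S w : ℝ → ℝ) (I : Set ℝ) : ℝ → ℝ :=
  (S '' I).indicator fun x =>
    |deriv S (Function.invFunOn S I x)|⁻¹ * w (Function.invFunOn S I x)

theorem branchDensity_apply {S : ℝ → ℝ} {I : Set ℝ} (hS : InjOn S I) (w : ℝ → ℝ) {y : ℝ}
    (hy : y ∈ I) : branchDensity S w I (S y) = |deriv S y|⁻¹ * w y := by
  rw [branchDensity, indicator_of_mem (mem_image_of_mem S hy), hS.leftInvOn_invFunOn hy]

theorem branchDensity_of_notMem {S : ℝ → ℝ} {I : Set ℝ} (w : ℝ → ℝ) {x : ℝ}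
    (hx : x ∉ S '' I) : branchDensity S w I x = 0 :=
  indicator_of_notMem hx _

theorem branchDensity_nonneg (S : ℝ → ℝ) {w : ℝ → ℝ} (hw : ∀ x, 0 ≤ w x) (I : Set ℝ) (x : ℝ) :
    0 ≤ branchDensity S w I x :=
  indicator_nonneg (fun _ _ => mul_nonneg (by positivity) (hw _)) _

theorem mapsTo_seqIter {T : ℕ → ℝ → ℝ} (hm : ∀ j, 1 ≤ j → MapsTo (T j) (Icc 0 1) (Icc 0 1))
    (n : ℕ) : MapsTo (seqIter T n) (Icc 0 1) (Icc 0 1) := by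
  induction n with
  | zero => exact mapsTo_id _
  | succ n ih => exact (hm (n + 1) (by omega)).comp ih

/-- Pairwise disjoint branches of `T_1^i` that cover almost all of `[0,1]`. -/
structure BranchFamily (T : ℕ → ℝ → ℝ) (lam c : ℝ) (i : ℕ) {ι : Type} (I : ι → Set ℝ) :
    Prop where
  branch : ∀ b, BranchOn T lam c i (I b)
  disjoint : Pairwise (Function.onFun Disjoint I)
  cover : ∀ᵐ x ∂leb01, ∃ b, x ∈ I b

section Formula

variable {T : ℕ → ℝ → ℝ} {lam c : ℝ} {i : ℕ}

/-- This is the change of variables along the injective branch; the Jacobian cancels the factor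
`1/|S'|`. -/
theorem BranchOn.branchDensity_integral {I : Set ℝ} (h : BranchOn T lam c i I) (hlam : 1 ≤ lam)
    (hT : ∀ j, 1 ≤ j → Measure.QuasiMeasurePreserving (T j) leb01 leb01)
    (hm : ∀ j, 1 ≤ j → MapsTo (T j) (Icc 0 1) (Icc 0 1)) {w : ℝ → ℝ} (hw : Integrable w leb01) :
    Integrable (branchDensity (seqIter T i) w I) leb01 ∧
    ∀ B, MeasurableSet B → ∫ x in B, branchDensity (seqIter T i) w I x ∂leb01 =
      ∫ x in I ∩ seqIter T i ⁻¹' B, w x := by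
  set S := seqIter T i
  have hSm : Measurable S := (quasiMeasurePreserving_seqIter hT i).measurable
  have hinj := h.injOn hlam
  have hIm : MeasurableSet I := h.isOpen.measurableSet
  have hI01 : I ⊆ Icc 0 1 := h.subset.trans Ioo_subset_Icc_self
  have himm : MeasurableSet (S '' I) := h.ordConnected_image.measurableSet
  have hsub : S '' I ⊆ Icc 0 1 := by
    rintro _ ⟨x, hx, rfl⟩
    exact mapsTo_seqIter hm i (hI01 hx)
  set u : ℝ → ℝ := fun x =>
    |deriv S (Function.invFunOn S I x)|⁻¹ * w (Function.invFunOn S I x) with hu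
  have hval : ∀ x ∈ I, |deriv S x| • u (S x) = w x := by
    intro x hx
    have : 0 < |deriv S x| := lt_of_lt_of_le one_pos (h.one_le_abs_deriv x hx)
    have hl : Function.invFunOn S I (S x) = x := hinj.leftInvOn_invFunOn hx
    simp only [hu, hl, smul_eq_mul]
    field_simp
  have hder : ∀ A ⊆ I, ∀ x ∈ A, HasDerivWithinAt S (deriv S x) A x := fun A hA x hx =>
    (h.differentiableAt x (hA hx)).hasDerivAt.hasDerivWithinAt
  have hdef : branchDensity S w I = (S '' I).indicator u := rfl
  constructor
  · rw [hdef, integrable_indicator_iff himm, IntegrableOn, leb01,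
      Measure.restrict_restrict_of_subset hsub]
    refine (integrableOn_image_iff_integrableOn_abs_deriv_smul hIm (hder I Subset.rfl) hinj u).2 ?_
    refine (integrableOn_congr_fun hval hIm).2 ?_
    have : IntegrableOn w I leb01 := hw.integrableOn
    rwa [IntegrableOn, leb01, Measure.restrict_restrict_of_subset hI01] at this
  · intro B hB
    have himg : S '' I ∩ B = S '' (I ∩ S ⁻¹' B) := (image_inter_preimage S I B).symm
    rw [hdef, setIntegral_indicator himm, leb01, Measure.restrict_restrict_of_subset
      (inter_subset_right.trans hsub), inter_comm, himg,
      integral_image_eq_integral_abs_deriv_smul (hIm.inter (hSm hB)) (hder _ inter_subset_left)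
        (hinj.mono inter_subset_left)]
    exact setIntegral_congr_fun (hIm.inter (hSm hB)) fun x hx => hval x hx.1

theorem BranchFamily.transferSeq_ae_eq {ι : Type} [Fintype ι] {I : ι → Set ℝ}
    (h : BranchFamily T lam c i I) (hlam : 1 ≤ lam)
    (hT : ∀ j, 1 ≤ j → Measure.QuasiMeasurePreserving (T j) leb01 leb01)
    (hm : ∀ j, 1 ≤ j → MapsTo (T j) (Icc 0 1) (Icc 0 1)) {w : ℝ → ℝ} (hw : Integrable w leb01) :
    transferSeq T i w =ᵐ[leb01] fun x => ∑ b, branchDensity (seqIter T i) w (I b) x := by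
  have hb := fun b => (h.branch b).branchDensity_integral hlam hT hm hw
  have hSm : Measurable (seqIter T i) := (quasiMeasurePreserving_seqIter hT i).measurable
  refine SeqDyn.transferSeq_ae_eq hT hw (integrable_finsetSum _ fun b _ => (hb b).1) i
    fun B hB => ?_
  rw [integral_finsetSum _ fun b _ => (hb b).1.integrableOn]
  simp_rw [fun b => (hb b).2 B hB]
  have hI01 : ∀ b, I b ∩ seqIter T i ⁻¹' B ⊆ Icc 0 1 := fun b =>
    inter_subset_left.trans ((h.branch b).subset.trans Ioo_subset_Icc_self)
  have h1 : ∀ b, ∫ x in I b ∩ seqIter T i ⁻¹' B, w x =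
      ∫ x in I b ∩ seqIter T i ⁻¹' B, w x ∂leb01 := fun b => by
    rw [leb01, Measure.restrict_restrict_of_subset (hI01 b)]
  simp_rw [h1]
  rw [← integral_iUnion_fintype
    (fun b => (h.branch b).isOpen.measurableSet.inter (hSm hB))
    (fun a b hab => (h.disjoint hab).mono inter_subset_left inter_subset_left)
    (fun b => hw.integrableOn)]
  refine setIntegral_congr_set ?_
  filter_upwards [h.cover] with x hx
  obtain ⟨b, hb⟩ := hx
  refine propext ⟨fun hx => ?_, fun hx => ?_⟩
  · obtain ⟨b, hb⟩ := mem_iUnion.1 hx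
    exact hb.2
  · exact mem_iUnion.2 ⟨b, hb, hx⟩

end Formula

/-! ### Summability of the branch weights -/

/-- The supremum of `1 / |S'|` on `I`. -/
noncomputable def weight (S : ℝ → ℝ) (I : Set ℝ) : ℝ := sSup ((fun x => |deriv S x|⁻¹) '' I)

theorem weight_nonneg (S : ℝ → ℝ) (I : Set ℝ) : 0 ≤ weight S I := by
  refine Real.sSup_nonneg ?_
  rintro _ ⟨x, -, rfl⟩
  positivity

/-- The convention `sSup ∅ = 0` lets empty branches stay in a family at no cost. -/
theorem weight_empty (S : ℝ → ℝ) : weight S ∅ = 0 := by simp [weight]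

theorem abs_sub_le_one {x y : ℝ} (hx : x ∈ Icc (0 : ℝ) 1) (hy : y ∈ Icc (0 : ℝ) 1) :
    |x - y| ≤ 1 :=
  abs_sub_le_iff.2 ⟨by linarith [hx.2, hy.1], by linarith [hx.1, hy.2]⟩

section Weight

variable {T : ℕ → ℝ → ℝ} {lam c : ℝ} {i : ℕ}

namespace BranchOn

variable {I : Set ℝ}

theorem inv_le_weight (h : BranchOn T lam c i I) {x : ℝ} (hx : x ∈ I) :
    |deriv (seqIter T i) x|⁻¹ ≤ weight (seqIter T i) I := by
  refine le_csSup ⟨1, ?_⟩ (mem_image_of_mem _ hx)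
  rintro _ ⟨y, hy, rfl⟩
  exact inv_le_one_of_one_le₀ (h.one_le_abs_deriv y hy)

theorem inv_le_inv_mul_exp (h : BranchOn T lam c i I) {x y : ℝ} (hx : x ∈ I) (hy : y ∈ I) :
    |deriv (seqIter T i) x|⁻¹ ≤ |deriv (seqIter T i) y|⁻¹ *
      Real.exp (c * |seqIter T i x - seqIter T i y|) := by
  have h1 := h.distort y hy x hx
  have hx0 : 0 < |deriv (seqIter T i) x| := lt_of_lt_of_le one_pos (h.one_le_abs_deriv x hx)
  have hy0 : 0 < |deriv (seqIter T i) y| := lt_of_lt_of_le one_pos (h.one_le_abs_deriv y hy)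
  rw [abs_sub_comm] at h1
  rw [inv_mul_eq_div, inv_eq_one_div, div_le_div_iff₀ hx0 hy0]
  linarith

theorem mem_Icc (h : BranchOn T lam c i I)
    (hm : ∀ j, 1 ≤ j → MapsTo (T j) (Icc 0 1) (Icc 0 1)) {x : ℝ} (hx : x ∈ I) :
    seqIter T i x ∈ Icc (0 : ℝ) 1 :=
  mapsTo_seqIter hm i (Ioo_subset_Icc_self (h.subset hx))

theorem inv_le_exp_mul (h : BranchOn T lam c i I) (hc : 0 ≤ c)
    (hm : ∀ j, 1 ≤ j → MapsTo (T j) (Icc 0 1) (Icc 0 1)) {x y : ℝ} (hx : x ∈ I) (hy : y ∈ I) :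
    |deriv (seqIter T i) x|⁻¹ ≤ Real.exp c * |deriv (seqIter T i) y|⁻¹ := by
  rw [mul_comm]
  refine (h.inv_le_inv_mul_exp hx hy).trans ?_
  gcongr
  exact mul_le_of_le_one_right hc (abs_sub_le_one (h.mem_Icc hm hx) (h.mem_Icc hm hy))

theorem weight_le (h : BranchOn T lam c i I) (hc : 0 ≤ c)
    (hm : ∀ j, 1 ≤ j → MapsTo (T j) (Icc 0 1) (Icc 0 1)) {y : ℝ} (hy : y ∈ I) :
    weight (seqIter T i) I ≤ Real.exp c * |deriv (seqIter T i) y|⁻¹ := by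
  refine csSup_le (Set.Nonempty.image _ ⟨y, hy⟩) ?_
  rintro _ ⟨x, hx, rfl⟩
  exact h.inv_le_exp_mul hc hm hx hy

theorem weight_succ_le {J : Set ℝ} {M : ℝ} (h : BranchOn T lam c i I)
    (hJ : ExpandingOn (T (i + 1)) lam M J) (hlam : 1 ≤ lam) :
    weight (seqIter T (i + 1)) (I ∩ seqIter T i ⁻¹' J) ≤ lam⁻¹ * weight (seqIter T i) I := by
  refine Real.sSup_le ?_ (mul_nonneg (by positivity) (weight_nonneg _ _))
  rintro _ ⟨x, ⟨hx, hxJ⟩, rfl⟩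
  simp only
  rw [h.deriv_succ hJ hx hxJ, abs_mul, mul_inv]
  gcongr
  · exact hJ.le_abs_deriv _ hxJ
  · exact h.inv_le_weight hx

end BranchOn

/-- The upper bound on the transferred density holds only almost everywhere, whereas it is needed at
the cutting points. Distortion transports it: move to a nearby typical point covered by the same
branches, at the price of a factor `exp c`. -/
theorem BranchFamily.sum_branchDensity_one_le {ι : Type} [Fintype ι] {I : ι → Set ℝ}
    (h : BranchFamily T lam c i I) (hlam : 1 ≤ lam) (hc : 0 ≤ c)
    (hT : ∀ j, 1 ≤ j → Measure.QuasiMeasurePreserving (T j) leb01 leb01)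
    (hm : ∀ j, 1 ≤ j → MapsTo (T j) (Icc 0 1) (Icc 0 1)) {B : ℝ} (hB0 : 0 ≤ B)
    (hB : ∀ᵐ x ∂leb01, transferSeq T i (fun _ => 1) x ≤ B) (a : ℝ) :
    ∑ b, branchDensity (seqIter T i) (fun _ => 1) (I b) a ≤ Real.exp c * B := by
  classical
  set S := seqIter T i
  by_cases hne : ∃ b, a ∈ S '' I b
  swap
  · push Not at hne
    rw [Finset.sum_eq_zero fun b _ => branchDensity_of_notMem _ (hne b)]
    positivity
  obtain ⟨b₀, hb₀⟩ := hne
  -- Finitely many branch images meet in a neighbourhood of `a`, which has positive measure and so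
  -- contains a point where the almost sure bound holds.
  have hU : (⋂ b ∈ {b | a ∈ S '' I b}, S '' I b) ∈ nhds a := by
    refine (Filter.biInter_mem (Set.toFinite _)).2 fun b hb => ?_
    obtain ⟨e, he, rfl⟩ := hb
    exact (h.branch b).image_mem_nhds hlam he
  have hae := (h.transferSeq_ae_eq hlam hT hm (integrable_const (1 : ℝ))).and hB
  rw [leb01, ae_restrict_iff' measurableSet_Icc] at hae
  have hpos := Measure.measure_pos_of_mem_nhds (volume : Measure ℝ) hU
  obtain ⟨x, hxU, hx⟩ := (frequently_ae_mem_iff.2 hpos.ne').and_eventually hae |>.exists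
  have hxU' : ∀ b, a ∈ S '' I b → x ∈ S '' I b := fun b hb => by
    simpa using mem_iInter₂.1 hxU b hb
  have hx01 : x ∈ Icc (0 : ℝ) 1 := by
    obtain ⟨e, he, rfl⟩ := hxU' b₀ hb₀
    exact (h.branch b₀).mem_Icc hm he
  obtain ⟨h1, h2⟩ := hx hx01
  rw [h1] at h2
  refine le_trans ?_ (mul_le_mul_of_nonneg_left h2 (Real.exp_pos c).le)
  rw [Finset.mul_sum]
  refine Finset.sum_le_sum fun b _ => ?_
  by_cases hb : a ∈ S '' I b
  · obtain ⟨e', he', rfl⟩ := hxU' b hb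
    obtain ⟨e, he, rfl⟩ := hb
    rw [branchDensity_apply ((h.branch b).injOn hlam) _ he,
      branchDensity_apply ((h.branch b).injOn hlam) _ he', mul_one, mul_one]
    exact (h.branch b).inv_le_exp_mul hc hm he he'
  · rw [branchDensity_of_notMem _ hb]
    exact mul_nonneg (Real.exp_pos c).le
      (branchDensity_nonneg _ (fun _ => zero_le_one) _ _)

/-! ### Expanding partitions -/

/-- The points `a` divide `[0,1]` into `k` intervals on which `T` is expanding. -/
structure HasExpandingPartition (T : ℝ → ℝ) (lam M : ℝ) (k : ℕ) (a : Fin (k + 1) → ℝ) :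
    Prop where
  strictMono : StrictMono a
  first : a 0 = 0
  last : a (Fin.last k) = 1
  expandingOn : ∀ l : Fin k, ExpandingOn T lam M (Ioo (a l.castSucc) (a l.succ))

theorem exists_mem_Ioo_of_partition {k : ℕ} {a : Fin (k + 1) → ℝ} {x : ℝ} (h0 : a 0 < x)
    (h1 : x < a (Fin.last k)) (hx : ∀ l, x ≠ a l) :
    ∃ l : Fin k, x ∈ Ioo (a l.castSucc) (a l.succ) := by
  by_contra! H
  have key : ∀ l : Fin (k + 1), a l < x := by
    intro l
    induction l using Fin.induction with
    | zero => exact h0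
    | succ l ih =>
      have := H l
      rw [mem_Ioo, not_and, not_lt] at this
      exact lt_of_le_of_ne (this ih) (hx _).symm
  exact lt_asymm h1 (key _)

namespace HasExpandingPartition

variable {T : ℝ → ℝ} {lam M : ℝ} {k : ℕ} {a : Fin (k + 1) → ℝ}

theorem ae_exists_mem (h : HasExpandingPartition T lam M k a) :
    ∀ᵐ x ∂leb01, ∃ l : Fin k, x ∈ Ioo (a l.castSucc) (a l.succ) := by
  have hnull : ∀ᵐ x ∂leb01, ∀ l, x ≠ a l := by
    rw [ae_all_iff]
    intro l
    have : leb01 {a l} = 0 := le_antisymm ((Measure.restrict_apply_le _ _).trans (by simp)) zero_le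
    exact measure_eq_zero_iff_ae_notMem.1 this
  filter_upwards [hnull, ae_mem_Icc] with x hx hx01
  refine exists_mem_Ioo_of_partition ?_ ?_ hx
  · exact lt_of_le_of_ne (h.first ▸ hx01.1) (hx 0).symm
  · exact lt_of_le_of_ne (h.last ▸ hx01.2) (hx _)

theorem subset (h : HasExpandingPartition T lam M k a) (l : Fin k) :
    Ioo (a l.castSucc) (a l.succ) ⊆ Icc 0 1 := fun _ hx =>
  ⟨h.first ▸ (h.strictMono.monotone (Fin.zero_le _)).trans hx.1.le,
    h.last ▸ hx.2.le.trans (h.strictMono.monotone (Fin.le_last _))⟩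

theorem disjoint (h : HasExpandingPartition T lam M k a) {l l' : Fin k} (hl : l ≠ l') :
    Disjoint (Ioo (a l.castSucc) (a l.succ)) (Ioo (a l'.castSucc) (a l'.succ)) := by
  wlog hlt : l < l' generalizing l l'
  · exact (this hl.symm (lt_of_le_of_ne (not_lt.1 hlt) hl.symm)).symm
  refine disjoint_left.2 fun x hx hx' => ?_
  have : a l.succ ≤ a l'.castSucc := h.strictMono.monotone (by
    rw [Fin.le_def]; simpa using hlt)
  linarith [hx.2, hx'.1]

/-- On each piece `T` is injective with `|T'| ≥ 1`, so a set there has measure at most that of its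
image; the preimage of a null set is thus null. -/
theorem quasiMeasurePreserving (h : HasExpandingPartition T lam M k a) (hlam : 1 ≤ lam)
    (hT : Measurable T) (hm : MapsTo T (Icc 0 1) (Icc 0 1)) :
    Measure.QuasiMeasurePreserving T leb01 leb01 := by
  refine ⟨hT, Measure.AbsolutelyContinuous.mk fun s hs h0 => ?_⟩
  rw [Measure.map_apply hT hs]
  have hs0 : volume (s ∩ Icc 0 1) = 0 := by
    rwa [leb01, Measure.restrict_apply hs] at h0
  have hpiece : ∀ l : Fin k, volume (Ioo (a l.castSucc) (a l.succ) ∩ T ⁻¹' s) = 0 := by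
    intro l
    have hE := h.expandingOn l
    set A := Ioo (a l.castSucc) (a l.succ) ∩ T ⁻¹' s
    have hA : MeasurableSet A := measurableSet_Ioo.inter (hT hs)
    have hAJ : ∀ x ∈ A, x ∈ Ioo (a l.castSucc) (a l.succ) := fun x hx => hx.1
    have hinj : InjOn T A := by
      intro x hx y hy hxy
      have := hE.expand x (hAJ x hx) y (hAJ y hy)
      rw [hxy, sub_self, abs_zero] at this
      have h2 : |x - y| ≤ 0 := by nlinarith [abs_nonneg (x - y)]
      exact sub_eq_zero.1 (abs_nonpos_iff.1 h2)
    have h1 := lintegral_image_eq_lintegral_abs_deriv_mul hA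
      (fun x hx => (hE.differentiableAt x (hAJ x hx)).hasDerivAt.hasDerivWithinAt) hinj
      (fun _ => 1)
    have h2 : volume (T '' A) = 0 := by
      refine measure_mono_null ?_ hs0
      rintro _ ⟨x, hx, rfl⟩
      exact ⟨hx.2, hm (h.subset l (hAJ x hx))⟩
    rw [setLIntegral_one, h2] at h1
    refine le_antisymm ?_ zero_le
    rw [h1, ← setLIntegral_one]
    refine setLIntegral_mono' hA fun x hx => ?_
    rw [mul_one, ← ENNReal.ofReal_one]
    exact ENNReal.ofReal_le_ofReal (hlam.trans (hE.le_abs_deriv x (hAJ x hx)))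
  have hae : ∀ᵐ x ∂leb01, x ∉ T ⁻¹' s := by
    have h3 : ∀ᵐ x ∂leb01, ∀ l : Fin k, x ∉ Ioo (a l.castSucc) (a l.succ) ∩ T ⁻¹' s :=
      ae_all_iff.2 fun l => measure_eq_zero_iff_ae_notMem.1
        (le_antisymm ((Measure.restrict_apply_le _ _).trans (hpiece l).le) zero_le)
    filter_upwards [h3, h.ae_exists_mem] with x hx ⟨l, hl⟩ hxs
    exact hx l ⟨hl, hxs⟩
  exact measure_eq_zero_iff_ae_notMem.2 hae

end HasExpandingPartition

end Weight

/-! ### Refinement of branches and a uniform bound on their total weight. -/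

section Refine

variable {T : ℕ → ℝ → ℝ} {lam c M : ℝ} {i : ℕ} {ι : Type} {I : ι → Set ℝ} {k : ℕ}
  {a : Fin (k + 1) → ℝ}

theorem BranchFamily.zero (T : ℕ → ℝ → ℝ) (lam : ℝ) {c : ℝ} (hc : 0 ≤ c) :
    BranchFamily T lam c 0 (fun _ : Unit => Ioo 0 1) where
  branch _ := BranchOn.zero T lam hc
  disjoint a b hab := (hab rfl).elim
  cover := by
    have : leb01 (Icc 0 1 \ Ioo 0 1) = 0 := by
      rw [Icc_sdiff_Ioo_same zero_le_one]
      exact le_antisymm ((Measure.restrict_apply_le _ _).trans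
        ((toFinite _).measure_zero _).le) zero_le
    filter_upwards [measure_eq_zero_iff_ae_notMem.1 this, ae_mem_Icc] with x hx hx01
    by_contra! hcon
    exact hx ⟨hx01, hcon ()⟩

theorem BranchFamily.succ (h : BranchFamily T lam c i I)
    (hP : HasExpandingPartition (T (i + 1)) lam M k a) (hlam : 1 ≤ lam) (hc0 : 0 ≤ c)
    (hc : c + M ≤ lam * c)
    (hT : ∀ j, 1 ≤ j → Measure.QuasiMeasurePreserving (T j) leb01 leb01) :
    BranchFamily T lam c (i + 1) (fun p : ι × Fin k =>
      I p.1 ∩ seqIter T i ⁻¹' Ioo (a p.2.castSucc) (a p.2.succ)) where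
  branch p := (h.branch p.1).succ (hP.expandingOn p.2) hlam hc0 hc
  disjoint p q hpq := by
    by_cases h1 : p.1 = q.1
    · have h2 : p.2 ≠ q.2 := fun h2 => hpq (Prod.ext h1 h2)
      exact ((hP.disjoint h2).preimage _).mono inter_subset_right inter_subset_right
    · exact (h.disjoint h1).mono inter_subset_left inter_subset_left
  cover := by
    filter_upwards [h.cover, (quasiMeasurePreserving_seqIter hT i).ae hP.ae_exists_mem]
      with x ⟨b, hb⟩ ⟨l, hl⟩
    exact ⟨(b, l), hb, hl⟩

/-- Cutting a branch creates one piece that inherits the old weight divided by `lam`. Every further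
nonempty piece has the left endpoint of its partition interval in the image of the branch, so
distortion bounds its weight by the branch density at that cutting point. -/
theorem BranchOn.sum_weight_succ_le {I : Set ℝ} (h : BranchOn T lam c i I)
    (hP : HasExpandingPartition (T (i + 1)) lam M k a) (hlam : 1 ≤ lam) (hc : 0 ≤ c)
    (hm : ∀ j, 1 ≤ j → MapsTo (T j) (Icc 0 1) (Icc 0 1)) :
    ∑ l : Fin k, weight (seqIter T (i + 1))
        (I ∩ seqIter T i ⁻¹' Ioo (a l.castSucc) (a l.succ)) ≤
      lam⁻¹ * (weight (seqIter T i) I + ∑ l : Fin k,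
        Real.exp c * branchDensity (seqIter T i) (fun _ => 1) I (a l.castSucc)) := by
  classical
  set S := seqIter T i
  have hbd0 : ∀ l : Fin k, 0 ≤ Real.exp c * branchDensity S (fun _ => 1) I (a l.castSucc) :=
    fun l => mul_nonneg (Real.exp_pos c).le (branchDensity_nonneg _ (fun _ => zero_le_one) _ _)
  by_cases hne : ∃ l : Fin k, (I ∩ S ⁻¹' Ioo (a l.castSucc) (a l.succ)).Nonempty
  swap
  · push Not at hne
    rw [Finset.sum_eq_zero fun l _ => by rw [hne l, weight_empty]]
    exact mul_nonneg (by positivity) (add_nonneg (weight_nonneg _ _)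
      (Finset.sum_nonneg fun l _ => hbd0 l))
  -- `l₀` is the first partition interval that the image of the branch meets; it alone is charged to
  -- the old weight.
  obtain ⟨l₀, hl₀, hmin⟩ := WellFounded.has_min (wellFounded_lt (α := Fin k))
    {l | (I ∩ S ⁻¹' Ioo (a l.castSucc) (a l.succ)).Nonempty} hne
  have hterm : ∀ l : Fin k, weight (seqIter T (i + 1))
      (I ∩ S ⁻¹' Ioo (a l.castSucc) (a l.succ)) ≤ lam⁻¹ * ((if l = l₀ then weight S I else 0) +
        Real.exp c * branchDensity S (fun _ => 1) I (a l.castSucc)) := by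
    intro l
    have hw := h.weight_succ_le (hP.expandingOn l) hlam
    by_cases hl : l = l₀
    · rw [if_pos hl]
      refine hw.trans ?_
      gcongr
      linarith [hbd0 l]
    rw [if_neg hl, zero_add]
    by_cases hle : (I ∩ S ⁻¹' Ioo (a l.castSucc) (a l.succ)).Nonempty
    swap
    · rw [not_nonempty_iff_eq_empty.1 hle, weight_empty]
      exact mul_nonneg (by positivity) (hbd0 l)
    refine hw.trans ?_
    gcongr
    have hlt : l₀ < l := lt_of_le_of_ne (not_lt.1 (hmin l hle)) (Ne.symm hl)
    obtain ⟨x, hxI, hx⟩ := hl₀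
    obtain ⟨y, hyI, hy⟩ := hle
    have hal : a l₀.succ ≤ a l.castSucc := hP.strictMono.monotone (by
      rw [Fin.le_def]; simpa using hlt)
    have hmem : a l.castSucc ∈ S '' I := h.ordConnected_image.out (mem_image_of_mem _ hxI)
      (mem_image_of_mem _ hyI) ⟨hx.2.le.trans hal, hy.1.le⟩
    obtain ⟨e, he, hee⟩ := hmem
    rw [← hee, branchDensity_apply (h.injOn hlam) _ he, mul_one]
    exact h.weight_le hc hm he
  refine (Finset.sum_le_sum fun l _ => hterm l).trans (le_of_eq ?_)
  rw [← Finset.mul_sum, Finset.sum_add_distrib, Finset.sum_ite_eq' Finset.univ l₀]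
  simp

theorem BranchFamily.sum_weight_succ_le [Fintype ι] (h : BranchFamily T lam c i I)
    (hP : HasExpandingPartition (T (i + 1)) lam M k a) (hlam : 1 ≤ lam) (hc : 0 ≤ c)
    (hT : ∀ j, 1 ≤ j → Measure.QuasiMeasurePreserving (T j) leb01 leb01)
    (hm : ∀ j, 1 ≤ j → MapsTo (T j) (Icc 0 1) (Icc 0 1)) {B : ℝ} (hB0 : 0 ≤ B)
    (hB : ∀ᵐ x ∂leb01, transferSeq T i (fun _ => 1) x ≤ B) :
    ∑ p : ι × Fin k, weight (seqIter T (i + 1))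
        (I p.1 ∩ seqIter T i ⁻¹' Ioo (a p.2.castSucc) (a p.2.succ)) ≤
      lam⁻¹ * (∑ b, weight (seqIter T i) (I b) + k * (Real.exp c * (Real.exp c * B))) := by
  rw [Fintype.sum_prod_type]
  refine (Finset.sum_le_sum fun b _ => (h.branch b).sum_weight_succ_le hP hlam hc hm).trans ?_
  rw [← Finset.mul_sum, Finset.sum_add_distrib, Finset.sum_comm]
  gcongr
  have hl : ∀ l : Fin k, ∑ b, Real.exp c * branchDensity (seqIter T i) (fun _ => 1) (I b)
      (a l.castSucc) ≤ Real.exp c * (Real.exp c * B) := by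
    intro l
    rw [← Finset.mul_sum]
    gcongr
    exact h.sum_branchDensity_one_le hlam hc hT hm hB0 hB _
  refine (Finset.sum_le_sum fun l _ => hl l).trans_eq ?_
  simp

/-- The total weight obeys `w_{i+1} ≤ (w_i + Q) / lam`. The fixed point of this recursion is `Q /
(lam - 1)`, and starting from `w_0 = 1` the weight never exceeds the fixed point plus `1`. -/
theorem exists_branchFamily {N : ℕ} (hlam : 1 < lam) (hc : 0 ≤ c) (hcM : c + M ≤ lam * c)
    (hT : ∀ j, 1 ≤ j → Measure.QuasiMeasurePreserving (T j) leb01 leb01)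
    (hm : ∀ j, 1 ≤ j → MapsTo (T j) (Icc 0 1) (Icc 0 1))
    (hP : ∀ j, 1 ≤ j → ∃ (k : ℕ) (a : Fin (k + 1) → ℝ), k ≤ N ∧
      HasExpandingPartition (T j) lam M k a)
    {B : ℝ} (hB0 : 0 ≤ B) (hB : ∀ i, ∀ᵐ x ∂leb01, transferSeq T i (fun _ => 1) x ≤ B) (i : ℕ) :
    ∃ (ι : Type) (_ : Fintype ι) (I : ι → Set ℝ), BranchFamily T lam c i I ∧
      ∑ b, weight (seqIter T i) (I b) ≤
        1 + N * (Real.exp c * (Real.exp c * B)) / (lam - 1) := by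
  set Q := N * (Real.exp c * (Real.exp c * B)) with hQ
  have hQ0 : 0 ≤ Q := by positivity
  have hl0 : 0 < lam - 1 := by linarith
  induction i with
  | zero =>
    refine ⟨Unit, inferInstance, _, BranchFamily.zero T lam hc, ?_⟩
    have : weight (seqIter T 0) (Ioo 0 1) = 1 := by
      have : (fun x => |deriv (seqIter T 0) x|⁻¹) = fun _ => (1 : ℝ) := by
        funext x
        simp [seqIter]
      rw [weight, this, (nonempty_Ioo.2 one_pos).image_const]
      simp
    simp only [Finset.univ_unique, Finset.sum_singleton, this]
    have := div_nonneg hQ0 hl0.le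
    linarith
  | succ i ih =>
    obtain ⟨ι, hι, I, hI, hsum⟩ := ih
    obtain ⟨k, a, hk, hP⟩ := hP (i + 1) (by omega)
    refine ⟨ι × Fin k, inferInstance, _, hI.succ hP hlam.le hc hcM hT, ?_⟩
    refine (hI.sum_weight_succ_le hP hlam.le hc hT hm hB0 (hB i)).trans ?_
    have hkQ : k * (Real.exp c * (Real.exp c * B)) ≤ Q := by
      rw [hQ]
      gcongr
    have hl : 0 < lam := by linarith
    rw [inv_mul_le_iff₀ hl]
    have : Q / (lam - 1) * (lam - 1) = Q := div_mul_cancel₀ _ hl0.ne'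
    nlinarith

end Refine

/-! ### Variation of the images under the transfer operators -/

theorem eVariationOn_le_of_abs_sub_le {h φ : ℝ → ℝ} {v : ℝ}
    (hh : ∀ x ∈ Icc (0 : ℝ) 1, ∀ y ∈ Icc (0 : ℝ) 1, x ≤ y → |h y - h x| ≤ φ y - φ x)
    (hv : φ 1 - φ 0 ≤ v) : eVariationOn h (Icc 0 1) ≤ ENNReal.ofReal v := by
  have hmono : MonotoneOn φ (Icc 0 1) := fun x hx y hy hxy =>
    sub_nonneg.1 ((abs_nonneg _).trans (hh x hx y hy hxy))
  have h1 : eVariationOn h (Icc 0 1) ≤ eVariationOn φ (Icc 0 1) := by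
    refine iSup_mono fun p => Finset.sum_le_sum fun j _ => ?_
    have h2 := hh _ (p.2.2.2 j) _ (p.2.2.2 (j + 1)) (p.2.2.1 (Nat.le_succ j))
    rw [edist_dist, edist_dist, Real.dist_eq, Real.dist_eq]
    exact ENNReal.ofReal_le_ofReal (h2.trans (le_abs_self _))
  have h3 := hmono.eVariationOn_eq (a := 0) (b := 1) (by simp) (by simp)
  rw [inter_self] at h3
  exact h1.trans (h3.le.trans (ENNReal.ofReal_le_ofReal hv))

/-- A monotone function controlling the increments of a function that vanishes off the interval
`Q`, is bounded by `s` and `q`-Lipschitz on `Q`. -/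
noncomputable def incrementBound (Q : Set ℝ) (s q x : ℝ) : ℝ :=
  (upperClosure Q : Set ℝ).indicator (fun _ => s) x +
    ((upperClosure Q : Set ℝ) \ Q).indicator (fun _ => s) x + q * x

theorem incrementBound_one_sub_zero_le (Q : Set ℝ) {s : ℝ} (hs : 0 ≤ s) (q : ℝ) :
    incrementBound Q s q 1 - incrementBound Q s q 0 ≤ 2 * s + q := by
  classical
  simp only [incrementBound, indicator_apply]
  split_ifs <;> linarith

/-- The first indicator pays for the jump on entering `Q`, the second for the jump on leaving it,
and the linear term for the Lipschitz variation inside. Since `Q` is an interval, the part of its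
upper closure outside `Q` lies entirely above it. -/
theorem abs_sub_le_incrementBound {h : ℝ → ℝ} {Q : Set ℝ} (hQ : Q.OrdConnected) {s q : ℝ}
    (hq : 0 ≤ q) (h0 : ∀ x ∉ Q, h x = 0) (hs : ∀ x ∈ Q, |h x| ≤ s)
    (hL : ∀ x ∈ Q, ∀ y ∈ Q, |h x - h y| ≤ q * |x - y|) {x y : ℝ} (hxy : x ≤ y) :
    |h y - h x| ≤ incrementBound Q s q y - incrementBound Q s q x := by
  classical
  have hup : ∀ {u v : ℝ}, u ≤ v → u ∈ (upperClosure Q : Set ℝ) → v ∈ (upperClosure Q : Set ℝ) :=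
    fun huv hu => (upperClosure Q).upper huv hu
  have hqxy : 0 ≤ q * (y - x) := mul_nonneg hq (by linarith)
  simp only [incrementBound, indicator_apply, mem_sdiff]
  by_cases hx : x ∈ Q <;> by_cases hy : y ∈ Q
  · have h1 := hL y hy x hx
    rw [abs_of_nonneg (sub_nonneg.2 hxy)] at h1
    have hx' := subset_upperClosure hx
    have hy' := subset_upperClosure hy
    simp only [hx, hy, hx', hy', if_true, not_true, and_false, if_false]
    linarith
  · have hx' := subset_upperClosure hx
    have hy' := hup hxy hx'
    have h1 := hs x hx
    simp only [hx, hy, hx', hy', if_true, not_true, and_false, if_false, not_false_eq_true,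
      and_self, h0 y hy, zero_sub, abs_neg]
    linarith
  · have hy' := subset_upperClosure hy
    have hx' : x ∉ (upperClosure Q : Set ℝ) := by
      intro hx'
      obtain ⟨z, hz, hzx⟩ := mem_upperClosure.1 hx'
      exact hx (hQ.out hz hy ⟨hzx, hxy⟩)
    have h1 := hs y hy
    simp only [hx, hy, hx', hy', if_true, not_true, and_false, if_false, false_and,
      h0 x hx, sub_zero]
    linarith
  · rw [h0 x hx, h0 y hy, sub_zero, abs_zero]
    by_cases hx' : x ∈ (upperClosure Q : Set ℝ)
    · have hy' := hup hxy hx'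
      simp only [hx, hy, hx', hy', if_true, not_false_eq_true, and_self]
      linarith
    · by_cases hy' : y ∈ (upperClosure Q : Set ℝ)
      · obtain ⟨z, hz, hzy⟩ := mem_upperClosure.1 hy'
        have hs0 := (abs_nonneg _).trans (hs z hz)
        simp only [hx, hy, hx', hy', if_true, if_false, not_false_eq_true, and_self, and_true]
        linarith
      · simp only [hx', hy', if_false, false_and]
        linarith

section Variation

variable {T : ℕ → ℝ → ℝ} {lam c : ℝ} {i : ℕ}

theorem BranchOn.abs_inv_sub_inv_le {I : Set ℝ} (h : BranchOn T lam c i I) (hc : 0 ≤ c)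
    (hm : ∀ j, 1 ≤ j → MapsTo (T j) (Icc 0 1) (Icc 0 1)) {x y : ℝ} (hx : x ∈ I) (hy : y ∈ I) :
    |(|deriv (seqIter T i) x|⁻¹ - |deriv (seqIter T i) y|⁻¹)| ≤
      weight (seqIter T i) I * (c * Real.exp c * |seqIter T i x - seqIter T i y|) := by
  have key : ∀ {x y : ℝ}, x ∈ I → y ∈ I →
      |deriv (seqIter T i) x|⁻¹ - |deriv (seqIter T i) y|⁻¹ ≤
      weight (seqIter T i) I * (c * Real.exp c * |seqIter T i x - seqIter T i y|) := by
    intro x y hx hy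
    have h1 := h.inv_le_inv_mul_exp hx hy
    have h2 := h.inv_le_weight hy
    set d := |seqIter T i x - seqIter T i y|
    have hd : d ≤ 1 := abs_sub_le_one (h.mem_Icc hm hx) (h.mem_Icc hm hy)
    have hd0 : 0 ≤ d := abs_nonneg _
    -- Multiply `1 - c d ≤ exp (-c d)` by `exp (c d)`, then use `d ≤ 1`.
    have h3 : Real.exp (c * d) - 1 ≤ c * Real.exp c * d := by
      have h4 : 1 - c * d ≤ Real.exp (-(c * d)) := by
        linarith [Real.add_one_le_exp (-(c * d))]
      have h5 : Real.exp (c * d) * Real.exp (-(c * d)) = 1 := by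
        rw [← Real.exp_add]; simp
      have h6 : Real.exp (c * d) ≤ Real.exp c :=
        Real.exp_le_exp.2 (mul_le_of_le_one_right hc hd)
      have h7 : 0 ≤ c * d := mul_nonneg hc hd0
      nlinarith [Real.exp_pos (c * d)]
    have h8 : 0 ≤ |deriv (seqIter T i) y|⁻¹ := by positivity
    have h9 : 0 ≤ c * Real.exp c * d := by positivity
    calc _ ≤ |deriv (seqIter T i) y|⁻¹ * (Real.exp (c * d) - 1) := by linarith
      _ ≤ |deriv (seqIter T i) y|⁻¹ * (c * Real.exp c * d) := by gcongr
      _ ≤ _ := by gcongr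
  refine abs_sub_le_iff.2 ⟨key hx hy, ?_⟩
  rw [abs_sub_comm (seqIter T i x)]
  exact key hy hx

theorem BranchOn.branchDensity_bounds {I : Set ℝ} (h : BranchOn T lam c i I) (hlam : 1 ≤ lam)
    (hc : 0 ≤ c) (hm : ∀ j, 1 ≤ j → MapsTo (T j) (Icc 0 1) (Icc 0 1)) {w : ℝ → ℝ} {s q : ℝ}
    (hs : ∀ x ∈ I, |w x| ≤ s)
    (hq : ∀ x ∈ I, ∀ y ∈ I, |w x - w y| ≤ q * |seqIter T i x - seqIter T i y|) :
    (∀ x ∈ seqIter T i '' I, |branchDensity (seqIter T i) w I x| ≤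
      weight (seqIter T i) I * s) ∧
    ∀ x ∈ seqIter T i '' I, ∀ y ∈ seqIter T i '' I,
      |branchDensity (seqIter T i) w I x - branchDensity (seqIter T i) w I y| ≤
        weight (seqIter T i) I * (q + s * (c * Real.exp c)) * |x - y| := by
  have hinj := h.injOn hlam
  have hW := weight_nonneg (seqIter T i) I
  constructor
  · rintro _ ⟨x, hx, rfl⟩
    rw [branchDensity_apply hinj w hx, abs_mul, abs_inv, abs_abs]
    exact mul_le_mul (h.inv_le_weight hx) (hs x hx) (abs_nonneg _) hW
  · rintro _ ⟨x, hx, rfl⟩ _ ⟨y, hy, rfl⟩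
    rw [branchDensity_apply hinj w hx, branchDensity_apply hinj w hy]
    have h1 := h.abs_inv_sub_inv_le hc hm hx hy
    have h2 := h.inv_le_weight hx
    have h3 := hq x hx y hy
    have h4 := hs y hy
    have h5 : 0 ≤ |deriv (seqIter T i) x|⁻¹ := by positivity
    set gx := |deriv (seqIter T i) x|⁻¹
    set gy := |deriv (seqIter T i) y|⁻¹
    have h6 : gx * w x - gy * w y = gx * (w x - w y) + (gx - gy) * w y := by ring
    rw [h6]
    refine (abs_add_le _ _).trans ?_
    rw [abs_mul, abs_mul, abs_of_nonneg h5]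
    have h7 := mul_le_mul h2 h3 (abs_nonneg _) hW
    have h8 := mul_le_mul h1 h4 (abs_nonneg _) ((abs_nonneg _).trans h1)
    nlinarith

/-- In the branch formula each branch contributes at most two jumps and a Lipschitz part to the
variation, all proportional to its weight. The third `s` in the bound is the `L¹` part of the norm.
-/
theorem BranchFamily.bvNorm_transferSeq_le {ι : Type} [Fintype ι] {I : ι → Set ℝ}
    (h : BranchFamily T lam c i I) (hlam : 1 ≤ lam) (hc : 0 ≤ c)
    (hT : ∀ j, 1 ≤ j → Measure.QuasiMeasurePreserving (T j) leb01 leb01)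
    (hm : ∀ j, 1 ≤ j → MapsTo (T j) (Icc 0 1) (Icc 0 1)) {w : ℝ → ℝ} (hw : Integrable w leb01)
    {s q W : ℝ} (hs0 : 0 ≤ s) (hq0 : 0 ≤ q) (hs : ∀ b, ∀ x ∈ I b, |w x| ≤ s)
    (hq : ∀ b, ∀ x ∈ I b, ∀ y ∈ I b, |w x - w y| ≤ q * |seqIter T i x - seqIter T i y|)
    (hW : ∑ b, weight (seqIter T i) (I b) ≤ W) :
    IsBV (transferSeq T i w) ∧
      bvNorm (transferSeq T i w) ≤ ENNReal.ofReal (W * (3 * s + q + s * (c * Real.exp c))) := by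
  set S := seqIter T i
  have hae := h.transferSeq_ae_eq hlam hT hm hw
  have hb := fun b => (h.branch b).branchDensity_bounds hlam hc hm (hs b) (hq b)
  set L := q + s * (c * Real.exp c) with hL
  have hL0 : 0 ≤ L := by positivity
  have hwt : ∀ b, 0 ≤ weight S (I b) := fun b => weight_nonneg _ _
  have hvar : essVar (transferSeq T i w) ≤ ENNReal.ofReal (W * (2 * s + L)) := by
    refine (essVar_le hae.symm).trans (eVariationOn_le_of_abs_sub_le
      (φ := fun x => ∑ b, incrementBound (S '' I b) (weight S (I b) * s) (weight S (I b) * L) x)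
      ?_ ?_)
    · intro x _ y _ hxy
      rw [← Finset.sum_sub_distrib, ← Finset.sum_sub_distrib]
      refine (Finset.abs_sum_le_sum_abs _ _).trans (Finset.sum_le_sum fun b _ => ?_)
      exact abs_sub_le_incrementBound (h.branch b).ordConnected_image
        (mul_nonneg (hwt b) hL0) (fun x hx => branchDensity_of_notMem w hx) (hb b).1 (hb b).2 hxy
    · rw [← Finset.sum_sub_distrib]
      refine (Finset.sum_le_sum fun b _ =>
        incrementBound_one_sub_zero_le _ (mul_nonneg (hwt b) hs0) _).trans ?_
      calc ∑ b, (2 * (weight S (I b) * s) + weight S (I b) * L) =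
          (∑ b, weight S (I b)) * (2 * s + L) := by
            rw [Finset.sum_mul]; exact Finset.sum_congr rfl fun b _ => by ring
        _ ≤ _ := by gcongr
  have hL1 : eLpNorm (transferSeq T i w) 1 leb01 ≤ ENNReal.ofReal (W * s) := by
    have : ∀ᵐ x ∂leb01, ‖transferSeq T i w x‖ ≤ W * s := by
      filter_upwards [hae] with x hx
      rw [hx, Real.norm_eq_abs]
      refine (Finset.abs_sum_le_sum_abs _ _).trans ?_
      calc _ ≤ ∑ b, weight S (I b) * s := Finset.sum_le_sum fun b _ => by
            by_cases hx : x ∈ S '' I b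
            · exact (hb b).1 x hx
            · rw [branchDensity_of_notMem w hx, abs_zero]
              exact mul_nonneg (hwt b) hs0
        _ = (∑ b, weight S (I b)) * s := by rw [Finset.sum_mul]
        _ ≤ _ := by gcongr
    simpa using eLpNorm_le_of_ae_bound (p := 1) this
  have hW0 : 0 ≤ W := (Finset.sum_nonneg fun b _ => hwt b).trans hW
  refine ⟨⟨integrable_transferSeq T hw i, hvar.trans_lt ENNReal.ofReal_lt_top⟩, ?_⟩
  refine (add_le_add hvar hL1).trans ?_
  rw [← ENNReal.ofReal_add (by positivity) (by positivity)]
  refine ENNReal.ofReal_le_ofReal (le_of_eq ?_)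
  rw [hL]
  ring

end Variation

/-! ### Consequences of decorrelation -/

theorem bvNorm_one_le : bvNorm (fun _ => 1) ≤ 1 := by
  have h1 : essVar (fun _ => 1) ≤ 0 := by
    refine (essVar_le (Filter.EventuallyEq.refl _ _)).trans ?_
    simp [eVariationOn]
  have h2 : eLpNorm (fun _ : ℝ => (1 : ℝ)) 1 leb01 = 1 := by
    simp [eLpNorm_one_eq_lintegral_enorm]
  calc bvNorm (fun _ => 1) ≤ 0 + 1 := add_le_add h1 h2.le
    _ = 1 := zero_add 1

theorem isBV_one : IsBV (fun _ => 1) :=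
  ⟨integrable_const _, (le_self_add.trans bvNorm_one_le).trans_lt ENNReal.one_lt_top⟩

theorem ae_abs_le_of_bvNorm_le {f : ℝ → ℝ} {b : ℝ} (hb : 0 ≤ b)
    (h : bvNorm f ≤ ENNReal.ofReal b) : ∀ᵐ x ∂leb01, |f x| ≤ b := by
  filter_upwards [ae_enorm_le_bvNorm f] with x hx
  have := hx.trans h
  rwa [Real.enorm_eq_ofReal_abs, ENNReal.ofReal_le_ofReal_iff hb] at this

/-- Write `P_{T_1} 1 = 1 + f`, where `f` has mean zero and bounded `BV` norm. The remaining `n`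
operators send `f` to something of size `O(θ^n)` and leave the same problem, for the shifted
sequence with one map fewer; the errors form a geometric series. -/
theorem exists_transferSeq_one_le {C : Set (ℝ → ℝ)} (hdec : ConditionDec C) {M₀ : ℝ≥0}
    (hM₀ : ∀ T ∈ C, ∀ f, IsBV f → bvNorm (transferOp T f) ≤ M₀ * bvNorm f)
    (hqmp : ∀ T ∈ C, Measure.QuasiMeasurePreserving T leb01 leb01) :
    ∃ B : ℝ, 0 ≤ B ∧ ∀ T : ℕ → ℝ → ℝ, (∀ j, 1 ≤ j → T j ∈ C) → ∀ n,
      ∀ᵐ x ∂leb01, transferSeq T n (fun _ => 1) x ≤ B := by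
  obtain ⟨θ, K, hθ, -, hK⟩ := hdec
  have hθ' : (θ : ℝ) < 1 := by exact_mod_cast hθ
  -- `M₀ + 1` bounds the `BV` norm of `P_{T_1} 1 - 1`. The `1` added to `K` covers the case of no
  -- further operator, where decorrelation says nothing.
  set D : ℝ := (K + 1) * (M₀ + 1) with hD
  have hD0 : 0 ≤ D := by positivity
  have key : ∀ n, ∀ T : ℕ → ℝ → ℝ, (∀ j, 1 ≤ j → T j ∈ C) →
      ∀ᵐ x ∂leb01, transferSeq T n (fun _ => 1) x ≤
        1 + D * ∑ l ∈ Finset.range n, (θ : ℝ) ^ l := by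
    intro n
    induction n with
    | zero =>
      intro T _
      simp [transferSeq]
    | succ n ih =>
      intro T hT
      set T' : ℕ → ℝ → ℝ := fun j => T (j + 1) with hT'
      have hTC' : ∀ j, 1 ≤ j → T' j ∈ C := fun j _ => hT (j + 1) (by omega)
      have hq' : ∀ j, 1 ≤ j → Measure.QuasiMeasurePreserving (T' j) leb01 leb01 :=
        fun j hj => hqmp _ (hTC' j hj)
      set f := transferOp (T 1) (fun _ => 1) with hf
      have hfint : Integrable f leb01 := integrable_transferOp _ _
      have h1int : Integrable (fun _ : ℝ => (1 : ℝ)) leb01 := integrable_const _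
      have hfbv : bvNorm f ≤ M₀ := (hM₀ _ (hT 1 le_rfl) _ isBV_one).trans
        (mul_le_of_le_one_right zero_le bvNorm_one_le)
      have hevar : essVar (fun x => f x - 1) ≤ essVar f := essVar_sub_const_le f 1
      have hebv : bvNorm (fun x => f x - 1) ≤ M₀ + 1 := by
        have h1 : eLpNorm (fun x => f x - 1) 1 leb01 ≤ eLpNorm f 1 leb01 + 1 := by
          refine (eLpNorm_sub_le hfint.1 h1int.1 le_rfl).trans ?_
          gcongr
          exact le_add_self.trans bvNorm_one_le
        calc _ ≤ essVar f + (eLpNorm f 1 leb01 + 1) := add_le_add hevar h1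
          _ = bvNorm f + 1 := by rw [bvNorm, add_assoc]
          _ ≤ _ := by gcongr
      have heBV : IsBV (fun x => f x - 1) :=
        ⟨hfint.sub h1int, hevar.trans_lt ((le_self_add.trans hfbv).trans_lt ENNReal.coe_lt_top)⟩
      have hmean : ∫ x, (f x - 1) ∂leb01 = 0 := by
        have := setIntegral_transferOp (hqmp _ (hT 1 le_rfl)) h1int MeasurableSet.univ
        rw [integral_sub hfint h1int]
        simp only [preimage_univ, Measure.restrict_univ] at this
        rw [← hf] at this
        rw [this, sub_self]
      have hdecay : bvNorm (transferSeq T' n (fun x => f x - 1)) ≤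
          ENNReal.ofReal (D * θ ^ n) := by
        have hrhs : ENNReal.ofReal (D * θ ^ n) =
            ((K : ℝ≥0∞) + 1) * θ ^ n * (M₀ + 1) := by
          have : D * (θ : ℝ) ^ n = (((K + 1) * θ ^ n * (M₀ + 1) : ℝ≥0) : ℝ) := by
            rw [hD]; push_cast; ring
          rw [this, ENNReal.ofReal_coe_nnreal]
          push_cast
          rfl
        rw [hrhs]
        rcases Nat.eq_zero_or_pos n with rfl | hn
        · rw [pow_zero, mul_one]
          exact hebv.trans (le_mul_of_one_le_left zero_le le_add_self)
        · refine (hK n hn T' hTC' _ heBV hmean).trans ?_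
          gcongr
          exact le_self_add
      have hsub := transferSeq_sub_ae_eq hq' hfint h1int n
      have hstep : transferSeq T (n + 1) (fun _ => 1) = transferSeq T' n f := by
        rw [add_comm n 1, transferSeq_add]
        rfl
      filter_upwards [ih T' hTC', hsub, ae_abs_le_of_bvNorm_le (by positivity) hdecay]
        with x hx1 hx2 hx3
      rw [hstep, Finset.sum_range_succ]
      have := (le_abs_self _).trans hx3
      rw [hx2] at this
      linarith
  have hgeo : ∀ n, ∑ l ∈ Finset.range n, (θ : ℝ) ^ l ≤ (1 - (θ : ℝ))⁻¹ := by
    intro n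
    rw [← tsum_geometric_of_lt_one θ.coe_nonneg hθ']
    exact (summable_geometric_of_lt_one θ.coe_nonneg hθ').sum_le_tsum _ fun _ _ => by positivity
  have hθ1 : 0 ≤ (1 - (θ : ℝ))⁻¹ := inv_nonneg.2 (by linarith)
  refine ⟨1 + D * (1 - (θ : ℝ))⁻¹, by positivity, fun T hT n => ?_⟩
  filter_upwards [key n T hT] with x hx
  refine hx.trans ?_
  gcongr
  exact hgeo n

/-- Exponential decay of the correlations between `T_1^(i+l)` and observables that are Lipschitz
functions of the orbit up to time `i`. -/
structure HasDecay (T : ℕ → ℝ → ℝ) (lam E θ : ℝ) : Prop where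
  qmp : ∀ j, 1 ≤ j → Measure.QuasiMeasurePreserving (T j) leb01 leb01
  mapsTo : ∀ j, 1 ≤ j → MapsTo (T j) (Icc 0 1) (Icc 0 1)
  one_lt : 1 < lam
  E_nonneg : 0 ≤ E
  θ_nonneg : 0 ≤ θ
  θ_lt_one : θ < 1
  decay : ∀ i l, 1 ≤ l → ∀ (w : ℝ → ℝ) (s q : ℝ), Integrable w leb01 → ∫ x, w x ∂leb01 = 0 →
    0 ≤ s → 0 ≤ q → (∀ x ∈ Icc (0 : ℝ) 1, |w x| ≤ s) →
    (∀ x ∈ Icc (0 : ℝ) 1, ∀ y ∈ Icc (0 : ℝ) 1,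
      (∀ j < i, lam * |seqIter T j x - seqIter T j y| ≤
        |seqIter T (j + 1) x - seqIter T (j + 1) y|) →
      |w x - w y| ≤ q * |seqIter T i x - seqIter T i y|) →
    ∀ B, MeasurableSet B → |∫ x in seqIter T (i + l) ⁻¹' B, w x ∂leb01| ≤
      E * θ ^ l * (s + q) * leb01.real (seqIter T (i + l) ⁻¹' B)

/-- Points of one branch expand at every step, so the hypothesis on pairs in `HasDecay.decay` yields
the Lipschitz bound branch by branch without naming branches. The transferred observable is then in
`BV` uniformly in `i`, and decorrelation acts on the next `l` steps. -/
theorem exists_hasDecay {C : Set (ℝ → ℝ)} (hC : IsAdmissibleClass C) {T : ℕ → ℝ → ℝ}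
    (hT : ∀ n, 1 ≤ n → T n ∈ C) (hmin : ConditionMin T) : ∃ lam E θ, HasDecay T lam E θ := by
  obtain ⟨lam, M, N, hlam, hM, -, hpart⟩ := hC.uniform
  obtain ⟨r, -, ρ, M₀, Cr, -, -, -, -, hM₀, -⟩ := hC.condD
  have hpiece : ∀ S ∈ C, ∃ (k : ℕ) (a : Fin (k + 1) → ℝ), k ≤ N ∧
      HasExpandingPartition S lam M k a := by
    intro S hS
    obtain ⟨k, a, hk, hp, hb⟩ := hpart S hS
    exact ⟨k, a, hk, hp.strictMono, hp.first, hp.last, fun l => hp.expandingOn hlam.le l (hb l)⟩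
  have hmaps : ∀ S ∈ C, MapsTo S (Icc 0 1) (Icc 0 1) := fun S hS =>
    let ⟨_, _, _, hp, _⟩ := hpart S hS
    hp.mapsTo
  have hqmp : ∀ S ∈ C, Measure.QuasiMeasurePreserving S leb01 leb01 := by
    intro S hS
    obtain ⟨_, _, _, hp, _⟩ := hpart S hS
    obtain ⟨_, _, _, hE⟩ := hpiece S hS
    exact hE.quasiMeasurePreserving hlam.le hp.measurable hp.mapsTo
  obtain ⟨B₁, hB₁0, hB₁⟩ := exists_transferSeq_one_le hC.condDec hM₀ hqmp
  have hTq : ∀ j, 1 ≤ j → Measure.QuasiMeasurePreserving (T j) leb01 leb01 :=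
    fun j hj => hqmp _ (hT j hj)
  have hTm : ∀ j, 1 ≤ j → MapsTo (T j) (Icc 0 1) (Icc 0 1) := fun j hj => hmaps _ (hT j hj)
  obtain ⟨θ, K, hθ, -, hK⟩ := hC.condDec
  obtain ⟨δ, hδ, hmin⟩ := hmin
  have hl0 : 0 < lam - 1 := by linarith
  set c := M / (lam - 1) with hc
  have hc0 : 0 ≤ c := by positivity
  have hcM : c + M ≤ lam * c := by
    have : c * (lam - 1) = M := div_mul_cancel₀ _ hl0.ne'
    linarith
  set W := 1 + N * (Real.exp c * (Real.exp c * B₁)) / (lam - 1) with hW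
  have hW0 : 0 ≤ W := by positivity
  -- `W (3 + c exp c)` comes from the `BV` bound at time `i`, `K` from decorrelation, and `1 / δ`
  -- from replacing `m(B)` by the measure of its preimage.
  refine ⟨lam, K * W * (3 + c * Real.exp c) / δ, θ, hTq, hTm, hlam, by positivity, θ.coe_nonneg,
    by exact_mod_cast hθ, ?_⟩
  intro i l hl w s q hw hw0 hs0 hq0 hs hq B hB
  obtain ⟨ι, _, I, hI, hsum⟩ := exists_branchFamily (T := T) (N := N) hlam hc0 hcM hTq hTm
    (fun j hj => hpiece _ (hT j hj)) hB₁0 (hB₁ T hT) i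
  have hI01 : ∀ b, I b ⊆ Icc 0 1 := fun b => (hI.branch b).subset.trans Ioo_subset_Icc_self
  obtain ⟨hbv, hnorm⟩ := hI.bvNorm_transferSeq_le hlam.le hc0 hTq hTm hw hs0 hq0
    (fun b x hx => hs x (hI01 b hx))
    (fun b x hx y hy => hq x (hI01 b hx) y (hI01 b hy) ((hI.branch b).expand x hx y hy)) hsum
  set R := W * (3 * s + q + s * (c * Real.exp c)) with hR
  have hR0 : 0 ≤ R := by positivity
  clear_value R
  have hdec := hK l hl (fun j => T (j + i)) (fun j hj => hT _ (by omega)) _ hbv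
    ((integral_transferSeq hTq hw i).trans hw0)
  rw [← transferSeq_add] at hdec
  have hle : bvNorm (transferSeq T (i + l) w) ≤ ENNReal.ofReal (K * θ ^ l * R) := by
    refine (hdec.trans (mul_le_mul_right hnorm _)).trans (le_of_eq ?_)
    rw [ENNReal.ofReal_mul (by positivity), ENNReal.ofReal_mul (by positivity),
      ENNReal.ofReal_coe_nnreal, ENNReal.ofReal_pow θ.coe_nonneg, ENNReal.ofReal_coe_nnreal]
  have hae := ae_abs_le_of_bvNorm_le (by positivity) hle
  rw [← setIntegral_transferSeq hTq hw _ hB]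
  have h1 : |∫ x in B, transferSeq T (i + l) w x ∂leb01| ≤ K * θ ^ l * R * leb01.real B := by
    rw [← Real.norm_eq_abs]
    refine norm_setIntegral_le_of_norm_le_const_ae (measure_lt_top _ _) ?_
    exact ae_restrict_of_ae hae
  -- Integrating the minoration of the transferred density over `B`.
  have h2 : δ * leb01.real B ≤ leb01.real (seqIter T (i + l) ⁻¹' B) := by
    have hone := setIntegral_transferOp (quasiMeasurePreserving_seqIter hTq (i + l))
      (integrable_const (1 : ℝ)) hB
    rw [setIntegral_const, smul_eq_mul, mul_one] at hone
    rw [← hone, mul_comm, ← smul_eq_mul, ← setIntegral_const]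
    refine setIntegral_mono_ae (integrable_const _).integrableOn
      (integrable_transferOp _ _).integrableOn ?_
    exact hmin (i + l) (by omega)
  refine h1.trans ?_
  have h3 : R ≤ W * (3 + c * Real.exp c) * (s + q) := by
    rw [hR, mul_assoc]
    gcongr
    nlinarith [mul_nonneg hc0 (Real.exp_pos c).le]
  calc K * θ ^ l * R * leb01.real B = K * θ ^ l * R / δ * (δ * leb01.real B) := by
        field_simp
    _ ≤ K * θ ^ l * (W * (3 + c * Real.exp c) * (s + q)) / δ *
        leb01.real (seqIter T (i + l) ⁻¹' B) := by gcongr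
    _ = _ := by ring

/-! ### Separately Lipschitz functionals of orbits -/

/-- `F` is Lipschitz with constant `1 / n` in each of the first `n` coordinates, and does not
depend on the others. -/
def IsMeanLipschitz (n : ℕ) (F : (ℕ → ℝ) → ℝ) : Prop :=
  ∀ u v : ℕ → ℝ, |F u - F v| ≤ (1 / (n : ℝ)) * ∑ k ∈ Finset.range n, |u k - v k|

/-- The sequence that agrees with the orbit of `x` before time `i` and with `z` from then on. -/
def mixOrbit (T : ℕ → ℝ → ℝ) (i : ℕ) (z : ℕ → ℝ) (x : ℝ) : ℕ → ℝ :=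
  fun k => if k < i then seqIter T k x else z k

/-- The continuation from time `p` of an orbit that is at `u` at time `p`. -/
def tailOrbit (T : ℕ → ℝ → ℝ) (p : ℕ) (u : ℝ) : ℕ → ℝ :=
  fun k => seqIter (fun j => T (j + p)) (k - p) u

theorem seqIter_add (T : ℕ → ℝ → ℝ) (p l : ℕ) (x : ℝ) :
    seqIter (fun j => T (j + p)) l (seqIter T p x) = seqIter T (p + l) x := by
  induction l with
  | zero => rfl
  | succ l ih =>
    have hl : l + 1 + p = p + l + 1 := by omega
    rw [seqIter, Function.comp_apply, ih, hl, ← add_assoc, seqIter, Function.comp_apply]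

theorem mixOrbit_tailOrbit (T : ℕ → ℝ → ℝ) (p : ℕ) (x : ℝ) :
    mixOrbit T p (tailOrbit T p (seqIter T p x)) x = fun k => seqIter T k x := by
  funext k
  unfold mixOrbit tailOrbit
  split_ifs with h
  · rfl
  · rw [seqIter_add]
    congr 1
    omega

namespace IsMeanLipschitz

variable {n : ℕ} {F : (ℕ → ℝ) → ℝ}

theorem continuous (hF : IsMeanLipschitz n F) : Continuous F := by
  refine continuous_iff_continuousAt.2 fun v => ?_
  rw [ContinuousAt, tendsto_iff_dist_tendsto_zero]
  refine squeeze_zero (fun _ => dist_nonneg) (fun u => hF u v) ?_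
  have hc : Continuous fun u : ℕ → ℝ => (1 / (n : ℝ)) * ∑ k ∈ Finset.range n, |u k - v k| := by
    fun_prop
  have := hc.tendsto v
  simpa using this

theorem abs_sub_le (hF : IsMeanLipschitz n F) (hn : 1 ≤ n) {u v : ℕ → ℝ} {d : ℝ}
    (h : ∀ k < n, |u k - v k| ≤ d) : |F u - F v| ≤ d := by
  have hn' : (0 : ℝ) < n := by exact_mod_cast hn
  refine (hF u v).trans ?_
  rw [one_div, inv_mul_le_iff₀ hn']
  refine (Finset.sum_le_card_nsmul _ _ d fun k hk => h k (Finset.mem_range.1 hk)).trans ?_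
  simp

theorem integrable (hF : IsMeanLipschitz n F) (hn : 1 ≤ n) {ψ : ℝ → ℕ → ℝ} (hψm : Measurable ψ)
    (hψ : ∀ x ∈ Icc (0 : ℝ) 1, ∀ k, ψ x k ∈ Icc (0 : ℝ) 1) :
    Integrable (fun x => F (ψ x)) leb01 := by
  refine Integrable.of_bound (hF.continuous.measurable.comp hψm).aestronglyMeasurable
    (|F 0| + 1) ?_
  filter_upwards [ae_mem_Icc] with x hx
  have h1 : |F (ψ x) - F 0| ≤ 1 := hF.abs_sub_le hn fun k _ =>
    abs_sub_le_one (hψ x hx k) (by simp)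
  rw [Real.norm_eq_abs]
  have := abs_sub_abs_le_abs_sub (F (ψ x)) (F 0)
  linarith

end IsMeanLipschitz

/-- Backwards in time the distances decay at least like powers of `1 / lam`, so a geometric series
bounds their sum by the last one. -/
theorem sum_abs_sub_le {T : ℕ → ℝ → ℝ} {lam : ℝ} (hlam : 1 < lam) {i : ℕ} {x y : ℝ}
    (h : ∀ j < i, lam * |seqIter T j x - seqIter T j y| ≤
      |seqIter T (j + 1) x - seqIter T (j + 1) y|) :
    ∑ j ∈ Finset.range (i + 1), |seqIter T j x - seqIter T j y| ≤
      lam / (lam - 1) * |seqIter T i x - seqIter T i y| := by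
  have hl : 0 < lam - 1 := by linarith
  induction i with
  | zero =>
    rw [zero_add, Finset.sum_range_one]
    refine le_mul_of_one_le_left (abs_nonneg _) ?_
    rw [one_le_div hl]
    linarith
  | succ i ih =>
    rw [Finset.sum_range_succ]
    have h1 := ih fun j hj => h j (by omega)
    have h2 := h i (by omega)
    have h3 : lam / (lam - 1) = 1 / (lam - 1) + 1 := by field_simp; ring
    have h4 : lam / (lam - 1) * |seqIter T i x - seqIter T i y| =
        1 / (lam - 1) * (lam * |seqIter T i x - seqIter T i y|) := by ring
    have h5 : 1 / (lam - 1) * (lam * |seqIter T i x - seqIter T i y|) ≤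
        1 / (lam - 1) * |seqIter T (i + 1) x - seqIter T (i + 1) y| := by gcongr
    rw [h3, add_mul, one_mul]
    linarith

/-! ### Decoupling the past of an orbit from a frozen future. -/

namespace HasDecay

variable {T : ℕ → ℝ → ℝ} {lam E θ : ℝ}

theorem measurable_seqIter (h : HasDecay T lam E θ) (n : ℕ) : Measurable (seqIter T n) :=
  (quasiMeasurePreserving_seqIter h.qmp n).measurable

theorem measurable_mixOrbit (h : HasDecay T lam E θ) (i : ℕ) (z : ℕ → ℝ) :
    Measurable (mixOrbit T i z) := by
  refine measurable_pi_lambda _ fun k => ?_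
  unfold mixOrbit
  split_ifs
  · exact h.measurable_seqIter k
  · exact measurable_const

theorem mixOrbit_mem (h : HasDecay T lam E θ) {i : ℕ} {z : ℕ → ℝ} (hz : ∀ k, z k ∈ Icc (0 : ℝ) 1)
    {x : ℝ} (hx : x ∈ Icc (0 : ℝ) 1) (k : ℕ) : mixOrbit T i z x k ∈ Icc (0 : ℝ) 1 := by
  unfold mixOrbit
  split_ifs
  · exact mapsTo_seqIter h.mapsTo k hx
  · exact hz k

theorem integrable_mixOrbit (h : HasDecay T lam E θ) {n : ℕ} (hn : 1 ≤ n) {F : (ℕ → ℝ) → ℝ}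
    (hF : IsMeanLipschitz n F) (i : ℕ) {z : ℕ → ℝ} (hz : ∀ k, z k ∈ Icc (0 : ℝ) 1) :
    Integrable (fun x => F (mixOrbit T i z x)) leb01 :=
  hF.integrable hn (h.measurable_mixOrbit i z) fun _ hx k => h.mixOrbit_mem hz hx k

theorem abs_setIntegral_mixOrbit_succ_sub_le (h : HasDecay T lam E θ) {n : ℕ} (hn : 1 ≤ n)
    {F : (ℕ → ℝ) → ℝ} (hF : IsMeanLipschitz n F) {z : ℕ → ℝ}
    (hz : ∀ k, z k ∈ Icc (0 : ℝ) 1) (i l : ℕ) (hl : 1 ≤ l) {B : Set ℝ} (hB : MeasurableSet B) :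
    |∫ x in seqIter T (i + l) ⁻¹' B, ((F (mixOrbit T (i + 1) z x) - F (mixOrbit T i z x)) -
        ∫ y, (F (mixOrbit T (i + 1) z y) - F (mixOrbit T i z y)) ∂leb01) ∂leb01| ≤
      E * θ ^ l * (2 / n + 2 / n * (lam / (lam - 1))) *
        leb01.real (seqIter T (i + l) ⁻¹' B) := by
  have hn' : (0 : ℝ) < n := by exact_mod_cast hn
  have hlam := h.one_lt
  have hl0 : 0 < lam - 1 := by linarith
  set φ : ℝ → ℝ := fun x => F (mixOrbit T (i + 1) z x) - F (mixOrbit T i z x) with hφ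
  have hφi : Integrable φ leb01 :=
    (h.integrable_mixOrbit hn hF (i + 1) hz).sub (h.integrable_mixOrbit hn hF i hz)
  have hφb : ∀ x ∈ Icc (0 : ℝ) 1, |φ x| ≤ 1 / n := by
    intro x hx
    refine (hF _ _).trans ?_
    refine mul_le_of_le_one_right (by positivity) ?_
    calc _ ≤ ∑ k ∈ Finset.range n, (if k = i then (1 : ℝ) else 0) := by
          refine Finset.sum_le_sum fun k _ => ?_
          split_ifs with hk
          · exact abs_sub_le_one (h.mixOrbit_mem hz hx k) (h.mixOrbit_mem hz hx k)
          · have : k < i + 1 ↔ k < i := by omega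
            simp [mixOrbit, this]
      _ ≤ 1 := by
          rw [Finset.sum_ite_eq']
          split_ifs <;> norm_num
  have hmean : |∫ y, φ y ∂leb01| ≤ 1 / n := by
    have := norm_integral_le_of_norm_le_const (μ := leb01) (f := φ) (C := 1 / n) (by
      filter_upwards [ae_mem_Icc] with x hx using hφb x hx)
    simpa using this
  have hmix : ∀ {x y : ℝ} {j : ℕ}, j ≤ i + 1 →
      |F (mixOrbit T j z x) - F (mixOrbit T j z y)| ≤ 1 / n *
        ∑ k ∈ Finset.range (i + 1), |seqIter T k x - seqIter T k y| := by
    intro x y j hj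
    refine (hF _ _).trans ?_
    gcongr
    calc _ = ∑ k ∈ Finset.range n, (if k < j then |seqIter T k x - seqIter T k y| else 0) := by
          refine Finset.sum_congr rfl fun k _ => ?_
          unfold mixOrbit
          split_ifs <;> simp
      _ = ∑ k ∈ (Finset.range n).filter (· < j), |seqIter T k x - seqIter T k y| := by
          rw [Finset.sum_filter]
      _ ≤ _ := by
          refine Finset.sum_le_sum_of_subset_of_nonneg (fun k hk => ?_) fun _ _ _ => abs_nonneg _
          rw [Finset.mem_filter] at hk
          exact Finset.mem_range.2 (by omega)
  -- The goal dictates `s = 2 / n`, since centring doubles the bound `1 / n`, and `q = 2 / n * (lam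
  -- / (lam - 1))`, one share for each of the two terms of `φ`.
  refine h.decay i l hl (fun x => φ x - ∫ y, φ y ∂leb01) _ _ (hφi.sub (integrable_const _)) ?_
    (by positivity) (by positivity) ?_ ?_ B hB
  · rw [integral_sub hφi (integrable_const _)]
    simp
  · intro x hx
    refine (abs_sub _ _).trans ?_
    have := hφb x hx
    have h2 : (2 : ℝ) / n = 1 / n + 1 / n := by ring
    rw [h2]
    exact add_le_add this hmean
  · intro x _ y _ hxy
    have h1 := sum_abs_sub_le hlam hxy
    have h2 := hmix (x := x) (y := y) (le_refl (i + 1))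
    have h3 := hmix (x := x) (y := y) (Nat.le_succ i)
    rw [sub_sub_sub_cancel_right]
    have h4 : φ x - φ y = (F (mixOrbit T (i + 1) z x) - F (mixOrbit T (i + 1) z y)) -
        (F (mixOrbit T i z x) - F (mixOrbit T i z y)) := by simp only [hφ]; ring
    rw [h4]
    refine (abs_sub _ _).trans ((add_le_add h2 h3).trans ?_)
    have h5 : 2 / (n : ℝ) * (lam / (lam - 1)) * |seqIter T i x - seqIter T i y| =
        2 * (1 / n * (lam / (lam - 1) * |seqIter T i x - seqIter T i y|)) := by ring
    rw [h5, ← two_mul]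
    gcongr

/-- Telescoping over the number of coordinates taken from the orbit: with none, the centred
functional is zero, and turning on coordinate `i` costs `O(θ^(p-i) / n)`. -/
theorem abs_setIntegral_mixOrbit_sub_le (h : HasDecay T lam E θ) {n : ℕ} (hn : 1 ≤ n)
    {F : (ℕ → ℝ) → ℝ} (hF : IsMeanLipschitz n F) {z : ℕ → ℝ}
    (hz : ∀ k, z k ∈ Icc (0 : ℝ) 1) (p : ℕ) {B : Set ℝ} (hB : MeasurableSet B) :
    |∫ x in seqIter T p ⁻¹' B, (F (mixOrbit T p z x) -
        ∫ y, F (mixOrbit T p z y) ∂leb01) ∂leb01| ≤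
      E * (2 + 2 * (lam / (lam - 1))) * (1 - θ)⁻¹ / n * leb01.real (seqIter T p ⁻¹' B) := by
  have hθ0 := h.θ_nonneg
  have hE := h.E_nonneg
  have hlam := h.one_lt
  have hl0 : 0 < lam - 1 := by linarith
  set Q := seqIter T p ⁻¹' B with hQ
  set ψ : ℕ → ℝ → ℝ := fun i x => F (mixOrbit T i z x) with hψ
  have hψi : ∀ i, Integrable (ψ i) leb01 := fun i => h.integrable_mixOrbit hn hF i hz
  set v : ℕ → ℝ := fun i => ∫ x in Q, (ψ i x - ∫ y, ψ i y ∂leb01) ∂leb01 with hv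
  have h0 : v 0 = 0 := by
    have : ∀ x, ψ 0 x = F z := fun x => by
      have : mixOrbit T 0 z x = z := by
        funext k
        simp [mixOrbit]
      simp only [hψ, this]
    simp [hv, this]
  have hdiff : ∀ i < p, |v (i + 1) - v i| ≤
      E * θ ^ (p - i) * (2 / n + 2 / n * (lam / (lam - 1))) * leb01.real Q := by
    intro i hi
    have h1 := h.abs_setIntegral_mixOrbit_succ_sub_le hn hF hz i (p - i) (by omega) hB
    have hpi : i + (p - i) = p := by omega
    rw [hpi] at h1
    refine le_trans (le_of_eq ?_) h1
    congr 1
    simp only [hv]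
    have hint : ∀ j, IntegrableOn (fun x => ψ j x - ∫ y, ψ j y ∂leb01) Q leb01 := fun j =>
      ((hψi j).sub (integrable_const _)).integrableOn
    rw [← integral_sub (hint _) (hint _)]
    refine integral_congr_ae (Filter.Eventually.of_forall fun x => ?_)
    simp only
    rw [integral_sub (hψi _) (hψi _)]
    ring
  have htel : v p = ∑ i ∈ Finset.range p, (v (i + 1) - v i) := by
    rw [Finset.sum_range_sub, h0, sub_zero]
  have hgeo : ∑ i ∈ Finset.range p, θ ^ (p - i) ≤ (1 - θ)⁻¹ := by
    rw [← Finset.sum_range_reflect]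
    calc _ ≤ ∑ i ∈ Finset.range p, θ ^ i := by
          refine Finset.sum_le_sum fun i hi => ?_
          have := Finset.mem_range.1 hi
          exact pow_le_pow_of_le_one hθ0 h.θ_lt_one.le (by omega)
      _ ≤ _ := by
          rw [← tsum_geometric_of_lt_one hθ0 h.θ_lt_one]
          exact (summable_geometric_of_lt_one hθ0 h.θ_lt_one).sum_le_tsum _
            fun _ _ => by positivity
  change |v p| ≤ _
  rw [htel]
  refine (Finset.abs_sum_le_sum_abs _ _).trans
    ((Finset.sum_le_sum fun i hi => hdiff i (Finset.mem_range.1 hi)).trans ?_)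
  calc _ = E * (2 / n + 2 / n * (lam / (lam - 1))) * leb01.real Q *
        ∑ i ∈ Finset.range p, θ ^ (p - i) := by
        rw [Finset.mul_sum]
        exact Finset.sum_congr rfl fun i _ => by ring
    _ ≤ E * (2 / n + 2 / n * (lam / (lam - 1))) * leb01.real Q * (1 - θ)⁻¹ := by gcongr
    _ = _ := by ring

end HasDecay

/-! ### Conditional expectations along the orbit -/

theorem abs_sub_le_of_floor_eq {n : ℕ} (hn : 1 ≤ n) {s t : ℝ} (hs : 0 ≤ s) (ht : 0 ≤ t)
    (h : ⌊n * s⌋₊ = ⌊n * t⌋₊) : |s - t| ≤ 1 / n := by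
  have hn' : (0 : ℝ) < n := by exact_mod_cast hn
  have h1 := Nat.floor_le (mul_nonneg hn'.le hs)
  have h2 := Nat.lt_floor_add_one ((n : ℝ) * s)
  have h3 := Nat.floor_le (mul_nonneg hn'.le ht)
  have h4 := Nat.lt_floor_add_one ((n : ℝ) * t)
  rw [h] at h1 h2
  rw [abs_sub_le_iff, le_div_iff₀ hn', le_div_iff₀ hn']
  constructor <;> linarith

/-- The mean over the past of `F`, for the future that starts at `u` at time `p`. -/
noncomputable def tailMean (T : ℕ → ℝ → ℝ) (F : (ℕ → ℝ) → ℝ) (p : ℕ) (u : ℝ) : ℝ :=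
  ∫ y, F (mixOrbit T p (tailOrbit T p u) y) ∂leb01

namespace HasDecay

variable {T : ℕ → ℝ → ℝ} {lam E θ : ℝ}

theorem measurable_tailOrbit (h : HasDecay T lam E θ) (p : ℕ) : Measurable (tailOrbit T p) :=
  measurable_pi_lambda _ fun k => (quasiMeasurePreserving_seqIter
    (T := fun j => T (j + p)) (fun j hj => h.qmp _ (by omega)) (k - p)).measurable

theorem tailOrbit_mem (h : HasDecay T lam E θ) {p : ℕ} {u : ℝ} (hu : u ∈ Icc (0 : ℝ) 1) (k : ℕ) :
    tailOrbit T p u k ∈ Icc (0 : ℝ) 1 :=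
  mapsTo_seqIter (T := fun j => T (j + p)) (fun j hj => h.mapsTo _ (by omega)) (k - p) hu

variable {n : ℕ} {F : (ℕ → ℝ) → ℝ}

theorem measurable_tailMean (h : HasDecay T lam E θ) (hF : IsMeanLipschitz n F) (p : ℕ) :
    Measurable (tailMean T F p) := by
  have hjoint : Measurable fun q : ℝ × ℝ => F (mixOrbit T p (tailOrbit T p q.1) q.2) := by
    refine hF.continuous.measurable.comp (measurable_pi_lambda _ fun k => ?_)
    unfold mixOrbit
    split_ifs
    · exact (h.measurable_seqIter k).comp measurable_snd
    · exact ((measurable_pi_apply k).comp (h.measurable_tailOrbit p)).comp measurable_fst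
  exact hjoint.stronglyMeasurable.integral_prod_right'.measurable

theorem integrable_tailMean (h : HasDecay T lam E θ) (hn : 1 ≤ n) (hF : IsMeanLipschitz n F)
    (p : ℕ) : Integrable (fun x => tailMean T F p (seqIter T p x)) leb01 := by
  refine Integrable.of_bound ((h.measurable_tailMean hF p).comp
    (h.measurable_seqIter p)).aestronglyMeasurable (|F 0| + 1) ?_
  filter_upwards [ae_mem_Icc] with x hx
  have hb : ∀ᵐ y ∂leb01, ‖F (mixOrbit T p (tailOrbit T p (seqIter T p x)) y)‖ ≤ |F 0| + 1 := by
    filter_upwards [ae_mem_Icc] with y hy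
    have h1 := hF.abs_sub_le hn (v := 0) fun k _ => abs_sub_le_one
      (h.mixOrbit_mem (i := p) (h.tailOrbit_mem (p := p) (mapsTo_seqIter h.mapsTo p hx)) hy k)
      (by simp)
    rw [Real.norm_eq_abs]
    have := abs_sub_abs_le_abs_sub (F (mixOrbit T p (tailOrbit T p (seqIter T p x)) y)) (F 0)
    linarith
  simpa [tailMean] using norm_integral_le_of_norm_le_const hb

theorem integrable_orbit (h : HasDecay T lam E θ) (hn : 1 ≤ n) (hF : IsMeanLipschitz n F) :
    Integrable (fun x => F fun k => seqIter T k x) leb01 :=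
  hF.integrable hn (measurable_pi_lambda _ fun k => h.measurable_seqIter k)
    fun _ hx k => mapsTo_seqIter h.mapsTo k hx

theorem abs_sub_tailMean_le (h : HasDecay T lam E θ) (hn : 1 ≤ n) (hF : IsMeanLipschitz n F)
    {p : ℕ} {x : ℝ} (hx : x ∈ Icc (0 : ℝ) 1) {z : ℕ → ℝ} (hz : ∀ k, z k ∈ Icc (0 : ℝ) 1)
    (hxz : ∀ k < n, |tailOrbit T p (seqIter T p x) k - z k| ≤ 1 / n) :
    |((F fun k => seqIter T k x) - tailMean T F p (seqIter T p x)) -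
      (F (mixOrbit T p z x) - ∫ y, F (mixOrbit T p z y) ∂leb01)| ≤ 2 / n := by
  have hclose : ∀ y, |F (mixOrbit T p (tailOrbit T p (seqIter T p x)) y) -
      F (mixOrbit T p z y)| ≤ 1 / n := fun y => hF.abs_sub_le hn fun k hk => by
    unfold mixOrbit
    split_ifs
    · simp
    · exact hxz k hk
  have h1 := hclose x
  rw [mixOrbit_tailOrbit] at h1
  have h2 : |tailMean T F p (seqIter T p x) - ∫ y, F (mixOrbit T p z y) ∂leb01| ≤ 1 / n := by
    rw [tailMean, ← integral_sub (h.integrable_mixOrbit hn hF p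
      (h.tailOrbit_mem (mapsTo_seqIter h.mapsTo p hx))) (h.integrable_mixOrbit hn hF p hz)]
    simpa using norm_integral_le_of_norm_le_const (μ := leb01)
      (f := fun y => F (mixOrbit T p (tailOrbit T p (seqIter T p x)) y) - F (mixOrbit T p z y))
      (Filter.Eventually.of_forall hclose)
  rw [sub_sub_sub_comm]
  refine (abs_sub _ _).trans ((add_le_add h1 h2).trans (le_of_eq ?_))
  ring

/-- The decoupling estimate needs a future independent of `x`, but the true future depends on `T_1^p
x`. Cut the values of `T_1^p x` into cells on which the relevant future coordinates vary by at most
`1 / n`; on a cell, a fixed future replaces the true one with error `2 / n`. The bounds are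
proportional to measure, so the number of cells does not matter. -/
theorem abs_setIntegral_orbit_sub_tailMean_le (h : HasDecay T lam E θ) (hn : 1 ≤ n)
    (hF : IsMeanLipschitz n F) (p : ℕ) {B : Set ℝ} (hB : MeasurableSet B) :
    |∫ x in seqIter T p ⁻¹' B,
        ((F fun k => seqIter T k x) - tailMean T F p (seqIter T p x)) ∂leb01| ≤
      (E * (2 + 2 * (lam / (lam - 1))) * (1 - θ)⁻¹ + 2) / n *
        leb01.real (seqIter T p ⁻¹' B) := by
  have hn' : (0 : ℝ) < n := by exact_mod_cast hn
  set D := E * (2 + 2 * (lam / (lam - 1))) * (1 - θ)⁻¹ with hD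
  set S := seqIter T p with hS
  have hSm : Measurable S := h.measurable_seqIter p
  set f : ℝ → ℝ := fun x => (F fun k => seqIter T k x) - tailMean T F p (S x) with hf
  have hfi : Integrable f leb01 := (h.integrable_orbit hn hF).sub (h.integrable_tailMean hn hF p)
  -- The floor of `n` times a number of `[0,1]` takes the `n + 1` values `0, ..., n`; the last
  -- occurs only at the endpoint `1`.
  let cell : (Fin n → Fin (n + 1)) → Set ℝ := fun v =>
    {u | ∀ k : Fin n, ⌊(n : ℝ) * tailOrbit T p u k⌋₊ = v k}
  have hcell : ∀ v, MeasurableSet (cell v) := by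
    intro v
    have : cell v = ⋂ k : Fin n, (fun u => ⌊(n : ℝ) * tailOrbit T p u k⌋₊) ⁻¹' {(v k : ℕ)} := by
      ext u
      simp [cell]
    rw [this]
    refine MeasurableSet.iInter fun k => ?_
    exact Nat.measurable_floor.comp (((measurable_pi_apply (k : ℕ)).comp
      (h.measurable_tailOrbit p)).const_mul _) (measurableSet_singleton _)
  have hdisj : Pairwise (Function.onFun Disjoint fun v => S ⁻¹' (B ∩ cell v)) := by
    intro v v' hv
    refine disjoint_left.2 fun x hx hx' => hv (funext fun k => Fin.ext ?_)
    rw [← hx.2 k, ← hx'.2 k]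
  have hunion : S ⁻¹' B =ᵐ[leb01] ⋃ v, S ⁻¹' (B ∩ cell v) := by
    filter_upwards [ae_mem_Icc] with x hx
    refine propext ⟨fun hxB => ?_, fun hxU => ?_⟩
    · refine mem_iUnion.2 ⟨fun k => ⟨⌊(n : ℝ) * tailOrbit T p (S x) k⌋₊, ?_⟩, hxB, fun k => rfl⟩
      have h1 := h.tailOrbit_mem (p := p) (mapsTo_seqIter h.mapsTo p hx) k
      rw [Nat.lt_succ_iff]
      exact Nat.floor_le_of_le (mul_le_of_le_one_right hn'.le h1.2)
    · obtain ⟨v, hv⟩ := mem_iUnion.1 hxU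
      exact hv.1
  have hmeas : ∀ v, MeasurableSet (S ⁻¹' (B ∩ cell v)) := fun v => hSm (hB.inter (hcell v))
  have hpiece : ∀ v, |∫ x in S ⁻¹' (B ∩ cell v), f x ∂leb01| ≤
      (D + 2) / n * leb01.real (S ⁻¹' (B ∩ cell v)) := by
    intro v
    by_cases hne : (cell v ∩ Icc 0 1).Nonempty
    · obtain ⟨u, huv, hu⟩ := hne
      have hz : ∀ k, tailOrbit T p u k ∈ Icc (0 : ℝ) 1 := h.tailOrbit_mem hu
      have h1 := h.abs_setIntegral_mixOrbit_sub_le hn hF hz p (hB.inter (hcell v))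
      set g : ℝ → ℝ := fun x => F (mixOrbit T p (tailOrbit T p u) x) -
        ∫ y, F (mixOrbit T p (tailOrbit T p u) y) ∂leb01 with hg
      have hgi : Integrable g leb01 :=
        (h.integrable_mixOrbit hn hF p hz).sub (integrable_const _)
      have h2 : |∫ x in S ⁻¹' (B ∩ cell v), (f x - g x) ∂leb01| ≤
          2 / n * leb01.real (S ⁻¹' (B ∩ cell v)) := by
        rw [← Real.norm_eq_abs]
        refine norm_setIntegral_le_of_norm_le_const_ae (measure_lt_top _ _) ?_
        filter_upwards [ae_restrict_of_ae ae_mem_Icc, ae_restrict_mem (hmeas v)] with x hx hxv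
        refine h.abs_sub_tailMean_le hn hF hx hz fun k hk => ?_
        refine abs_sub_le_of_floor_eq hn
          (h.tailOrbit_mem (mapsTo_seqIter h.mapsTo p hx) k).1 (hz k).1 ?_
        exact (hxv.2 ⟨k, hk⟩).trans (huv ⟨k, hk⟩).symm
      rw [integral_sub hfi.integrableOn hgi.integrableOn] at h2
      have h3 := abs_add_le (∫ x in S ⁻¹' (B ∩ cell v), g x ∂leb01)
        (∫ x in S ⁻¹' (B ∩ cell v), f x ∂leb01 - ∫ x in S ⁻¹' (B ∩ cell v), g x ∂leb01)
      rw [add_sub_cancel] at h3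
      refine h3.trans ((add_le_add h1 h2).trans (le_of_eq ?_))
      rw [hD]
      ring
    · have h0 : leb01 (S ⁻¹' (B ∩ cell v)) = 0 := by
        rw [measure_eq_zero_iff_ae_notMem]
        filter_upwards [ae_mem_Icc] with x hx hxv
        exact hne ⟨S x, hxv.2, mapsTo_seqIter h.mapsTo p hx⟩
      rw [setIntegral_measure_zero _ h0, abs_zero, measureReal_def, h0]
      simp
  rw [setIntegral_congr_set hunion, integral_iUnion_fintype hmeas hdisj fun _ => hfi.integrableOn,
    measureReal_congr hunion, measureReal_iUnion_fintype hdisj hmeas, Finset.mul_sum]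
  exact (Finset.abs_sum_le_sum_abs _ _).trans (Finset.sum_le_sum fun v _ => hpiece v)

end HasDecay

/-- A function measurable for `m` is determined by its integrals over sets of `m`, so the comparison
with `±b` is made for the measure trimmed to `m`. -/
theorem ae_abs_condExp_le {Ω : Type*} {m m₀ : MeasurableSpace Ω} {μ : Measure Ω}
    [IsFiniteMeasure μ] (hm : m ≤ m₀) {f : Ω → ℝ} (hf : Integrable f μ) {b : ℝ}
    (H : ∀ s, MeasurableSet[m] s → |∫ x in s, f x ∂μ| ≤ b * μ.real s) :
    ∀ᵐ x ∂μ, |(μ[f | m]) x| ≤ b := by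
  have hsm : StronglyMeasurable[m] (μ[f | m]) := stronglyMeasurable_condExp
  have hint : Integrable (μ[f | m]) (μ.trim hm) := integrable_condExp.trim hm hsm
  have hset : ∀ s, MeasurableSet[m] s →
      ∫ x in s, (μ[f | m]) x ∂(μ.trim hm) = ∫ x in s, f x ∂μ := by
    intro s hs
    rw [← setIntegral_trim hm hsm hs, setIntegral_condExp hm hf hs]
  have hconst : ∀ s, MeasurableSet[m] s → ∀ b : ℝ,
      ∫ _ in s, b ∂(μ.trim hm) = b * μ.real s := by
    intro s hs b
    rw [setIntegral_const, smul_eq_mul, mul_comm, measureReal_def, trim_measurableSet_eq hm hs,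
      measureReal_def]
  have hup : (μ[f | m]) ≤ᵐ[μ.trim hm] fun _ => b := by
    refine ae_le_of_forall_setIntegral_le hint (integrable_const _) fun s hs _ => ?_
    rw [hset s hs, hconst s hs]
    exact (le_abs_self _).trans (H s hs)
  have hlow : (fun _ => -b) ≤ᵐ[μ.trim hm] (μ[f | m]) := by
    refine ae_le_of_forall_setIntegral_le (integrable_const _) hint fun s hs _ => ?_
    rw [hset s hs, hconst s hs]
    linarith [(abs_le.1 (H s hs)).1]
  filter_upwards [ae_le_of_ae_le_trim hup, ae_le_of_ae_le_trim hlow] with x h1 h2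
  exact abs_le.2 ⟨h2, h1⟩

/-- `tailMean` composed with `T_1^p` is already measurable for the conditioning σ-algebra, so
conditioning leaves it unchanged and only the difference has to be estimated on sets `(T_1^p)⁻¹ B`.
-/
theorem HasDecay.ae_abs_condExp_sub_tailMean_le {T : ℕ → ℝ → ℝ} {lam E θ : ℝ} {n : ℕ}
    {F : (ℕ → ℝ) → ℝ} (h : HasDecay T lam E θ) (hn : 1 ≤ n) (hF : IsMeanLipschitz n F) (p : ℕ) :
    ∀ᵐ x ∂leb01, |(leb01[fun x => F fun k => seqIter T k x |
        MeasurableSpace.comap (seqIter T p) inferInstance]) x - tailMean T F p (seqIter T p x)| ≤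
      (E * (2 + 2 * (lam / (lam - 1))) * (1 - θ)⁻¹ + 2) / n := by
  have hm : MeasurableSpace.comap (seqIter T p) inferInstance ≤ (inferInstance : MeasurableSpace ℝ) :=
    (h.measurable_seqIter p).comap_le
  have hZ := h.integrable_orbit hn hF
  have hJ := h.integrable_tailMean hn hF p
  have hJm : StronglyMeasurable[MeasurableSpace.comap (seqIter T p) inferInstance]
      (fun x => tailMean T F p (seqIter T p x)) :=
    ((h.measurable_tailMean hF p).comp (comap_measurable _)).stronglyMeasurable
  have h1 := ae_abs_condExp_le hm (hZ.sub hJ)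
    (b := (E * (2 + 2 * (lam / (lam - 1))) * (1 - θ)⁻¹ + 2) / n) (by
      rintro _ ⟨B, hB, rfl⟩
      exact h.abs_setIntegral_orbit_sub_tailMean_le hn hF p hB)
  have h2 := condExp_sub hZ hJ (MeasurableSpace.comap (seqIter T p) inferInstance)
  rw [condExp_of_stronglyMeasurable hm hJm hJ] at h2
  filter_upwards [h1, h2] with x hx1 hx2
  rw [hx2] at hx1
  exact hx1

/-! ### Exponential moments -/

/-- By convexity, the exponential lies below its chord over `[-a, a]`. For `a = 0` the quotient `u /
a` is `0` by convention, and `u = 0`. -/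
theorem exp_le_cosh_add {u a : ℝ} (h : |u| ≤ a) :
    Real.exp u ≤ Real.cosh a + u / a * Real.sinh a := by
  rcases (abs_nonneg u).trans h |>.eq_or_lt with ha | ha
  · rw [← ha] at h ⊢
    rw [abs_nonpos_iff.1 h]
    simp
  · obtain ⟨h1, h2⟩ := abs_le.1 h
    have w1 : 0 ≤ (a + u) / (2 * a) := div_nonneg (by linarith) (by linarith)
    have w2 : 0 ≤ (a - u) / (2 * a) := div_nonneg (by linarith) (by linarith)
    have hc := convexOn_exp.2 (mem_univ a) (mem_univ (-a)) w1 w2 (by field_simp; ring)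
    have h3 : ((a + u) / (2 * a)) • a + ((a - u) / (2 * a)) • (-a) = u := by
      simp only [smul_eq_mul]
      field_simp
      ring
    rw [h3] at hc
    refine hc.trans (le_of_eq ?_)
    rw [Real.cosh_eq, Real.sinh_eq]
    simp only [smul_eq_mul]
    field_simp
    ring

/-- One step of Azuma-Hoeffding. In the chord bound for `exp (s (X - Y))`, with `Y` the conditional
expectation, the linear term is orthogonal to the `m`-measurable factor `exp (s Y)`; the constant
term is `cosh (|s| d) ≤ exp (s² d² / 2)`. -/
theorem integral_exp_le_of_condExp {Ω : Type*} {m m₀ : MeasurableSpace Ω} {μ : Measure Ω}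
    [IsFiniteMeasure μ] (hm : m ≤ m₀) {X : Ω → ℝ} (hX : Integrable X μ) {R d : ℝ}
    (hR : ∀ᵐ x ∂μ, |X x| ≤ R) (hd : ∀ᵐ x ∂μ, |X x - (μ[X | m]) x| ≤ d) (s : ℝ) :
    ∫ x, Real.exp (s * X x) ∂μ ≤
      Real.exp (s ^ 2 * d ^ 2 / 2) * ∫ x, Real.exp (s * (μ[X | m]) x) ∂μ := by
  set Y := μ[X | m] with hY
  have hYi : Integrable Y μ := integrable_condExp
  have hYm : StronglyMeasurable[m] Y := stronglyMeasurable_condExp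
  have hYR : ∀ᵐ x ∂μ, |Y x| ≤ R + d := by
    filter_upwards [hR, hd] with x h1 h2
    have := abs_sub (X x) (X x - Y x)
    rw [sub_sub_cancel] at this
    linarith
  have hexp : ∀ {V : Ω → ℝ} {r : ℝ}, AEStronglyMeasurable V μ → (∀ᵐ x ∂μ, |V x| ≤ r) →
      Integrable (fun x => Real.exp (s * V x)) μ := by
    intro V r hV hr
    refine Integrable.of_bound (Real.continuous_exp.comp_aestronglyMeasurable (hV.const_mul s))
      (Real.exp (|s| * r)) ?_
    filter_upwards [hr] with x hx
    rw [Real.norm_eq_abs, Real.abs_exp]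
    refine Real.exp_le_exp.2 ((le_abs_self _).trans ?_)
    rw [abs_mul]
    gcongr
  have hgi : Integrable (fun x => Real.exp (s * Y x)) μ := hexp hYi.1 hYR
  have hgm : StronglyMeasurable[m] (fun x => Real.exp (s * Y x)) :=
    Real.continuous_exp.comp_stronglyMeasurable (hYm.const_mul s)
  have hgX : Integrable (fun x => Real.exp (s * Y x) * X x) μ :=
    hgi.mul_bdd hX.1 (by simpa using hR)
  have hgY : Integrable (fun x => Real.exp (s * Y x) * Y x) μ :=
    hgi.mul_bdd hYi.1 (by simpa using hYR)
  have horth : ∫ x, Real.exp (s * Y x) * X x ∂μ = ∫ x, Real.exp (s * Y x) * Y x ∂μ := by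
    rw [← integral_condExp hm]
    exact integral_congr_ae (condExp_mul_of_stronglyMeasurable_left hgm hgX hX)
  set a := |s| * d with ha
  set β := s / a * Real.sinh a with hβ
  have hpt : ∀ᵐ x ∂μ, Real.exp (s * X x) ≤
      Real.cosh a * Real.exp (s * Y x) +
        β * (Real.exp (s * Y x) * X x - Real.exp (s * Y x) * Y x) := by
    filter_upwards [hd] with x hx
    have h1 : |s * (X x - Y x)| ≤ a := by
      rw [abs_mul, ha]
      gcongr
    have h2 : Real.exp (s * X x) = Real.exp (s * Y x) * Real.exp (s * (X x - Y x)) := by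
      rw [← Real.exp_add]
      ring_nf
    rw [h2]
    refine (mul_le_mul_of_nonneg_left (exp_le_cosh_add h1) (Real.exp_pos _).le).trans
      (le_of_eq ?_)
    rw [hβ]
    ring
  have hi1 := hgi.const_mul (Real.cosh a)
  have hi2 : Integrable (fun x => β * (Real.exp (s * Y x) * X x - Real.exp (s * Y x) * Y x)) μ :=
    (hgX.sub hgY).const_mul β
  calc ∫ x, Real.exp (s * X x) ∂μ ≤ ∫ x, (Real.cosh a * Real.exp (s * Y x) +
        β * (Real.exp (s * Y x) * X x - Real.exp (s * Y x) * Y x)) ∂μ :=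
        integral_mono_ae (hexp hX.1 hR) (hi1.add hi2) hpt
    _ = Real.cosh a * ∫ x, Real.exp (s * Y x) ∂μ := by
        rw [integral_add hi1 hi2, integral_const_mul, integral_const_mul, integral_sub hgX hgY,
          horth]
        simp
    _ ≤ _ := by
        gcongr
        refine (Real.cosh_le_exp_half_sq a).trans (le_of_eq ?_)
        rw [ha, mul_pow, sq_abs]

/-! ### Reverse martingale differences along the orbit. -/

namespace HasDecay

variable {T : ℕ → ℝ → ℝ} {lam E θ : ℝ} {n : ℕ} {F : (ℕ → ℝ) → ℝ}

/-- After coupling through the same past `y`, the two sequences differ only at coordinate `p`, which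
belongs to the future of `x` in one and to the past `y` in the other. -/
theorem abs_tailMean_sub_succ_le (h : HasDecay T lam E θ) (hn : 1 ≤ n)
    (hF : IsMeanLipschitz n F) (p : ℕ) {x : ℝ} (hx : x ∈ Icc (0 : ℝ) 1) :
    |tailMean T F p (seqIter T p x) - tailMean T F (p + 1) (seqIter T (p + 1) x)| ≤ 1 / n := by
  have hi : ∀ p, Integrable (fun y => F (mixOrbit T p (tailOrbit T p (seqIter T p x)) y)) leb01 :=
    fun p => h.integrable_mixOrbit hn hF p (h.tailOrbit_mem (mapsTo_seqIter h.mapsTo p hx))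
  rw [tailMean, tailMean, ← integral_sub (hi p) (hi (p + 1))]
  have hb : ∀ᵐ y ∂leb01, ‖F (mixOrbit T p (tailOrbit T p (seqIter T p x)) y) -
      F (mixOrbit T (p + 1) (tailOrbit T (p + 1) (seqIter T (p + 1) x)) y)‖ ≤ 1 / n := by
    filter_upwards [ae_mem_Icc] with y hy
    refine (hF _ _).trans (mul_le_of_le_one_right (by positivity) ?_)
    calc _ ≤ ∑ k ∈ Finset.range n, (if k = p then (1 : ℝ) else 0) := by
          refine Finset.sum_le_sum fun k _ => ?_
          unfold mixOrbit tailOrbit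
          rw [seqIter_add, seqIter_add]
          rcases lt_trichotomy k p with hk | rfl | hk
          · simp [hk, hk.ne, Nat.lt_succ_of_lt hk]
          · rw [if_neg (lt_irrefl k), if_pos (Nat.lt_succ_self k), if_pos rfl,
              Nat.add_sub_cancel' le_rfl]
            exact abs_sub_le_one (mapsTo_seqIter h.mapsTo _ hx) (mapsTo_seqIter h.mapsTo _ hy)
          · rw [if_neg hk.not_gt, if_neg (by omega), if_neg hk.ne', Nat.add_sub_cancel' hk.le,
              Nat.add_sub_cancel' (by omega), sub_self, abs_zero]
      _ ≤ 1 := by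
          rw [Finset.sum_ite_eq']
          split_ifs <;> norm_num
  simpa using norm_integral_le_of_norm_le_const hb

theorem tailMean_eq_integral (hn : 1 ≤ n) (hF : IsMeanLipschitz n F) (u : ℝ) :
    tailMean T F n u = ∫ y, F (fun k => seqIter T k y) ∂leb01 := by
  refine integral_congr_ae (Filter.Eventually.of_forall fun y => ?_)
  refine sub_eq_zero.1 (abs_nonpos_iff.1 (hF.abs_sub_le hn fun k hk => ?_))
  simp [mixOrbit, hk]

theorem integral_exp_orbit_le (h : HasDecay T lam E θ) (hn : 1 ≤ n) (hF : IsMeanLipschitz n F)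
    {D : ℝ} (hD : D = 2 * (E * (2 + 2 * (lam / (lam - 1))) * (1 - θ)⁻¹ + 2) + 1) (s : ℝ) :
    ∫ x, Real.exp (s * F fun k => seqIter T k x) ∂leb01 ≤
      Real.exp (s ^ 2 * D ^ 2 / n) *
        Real.exp (s * ∫ x, F (fun k => seqIter T k x) ∂leb01) := by
  have hn' : (0 : ℝ) < n := by exact_mod_cast hn
  set D₁ := E * (2 + 2 * (lam / (lam - 1))) * (1 - θ)⁻¹ + 2 with hD₁
  have hD₁0 : 0 ≤ D₁ := by
    have h1 := h.E_nonneg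
    have h2 : 0 < lam - 1 := by linarith [h.one_lt]
    have h3 : 0 < lam := by linarith
    have h4 : 0 < 1 - θ := by linarith [h.θ_lt_one]
    positivity
  set Z : ℝ → ℝ := fun x => F fun k => seqIter T k x with hZdef
  have hZ : Integrable Z leb01 := h.integrable_orbit hn hF
  have hZm : Measurable Z := hF.continuous.measurable.comp
    (measurable_pi_lambda _ fun k => h.measurable_seqIter k)
  set 𝓑 : ℕ → MeasurableSpace ℝ := fun p => MeasurableSpace.comap (seqIter T p) inferInstance
    with h𝓑
  have hm : ∀ p, 𝓑 p ≤ (inferInstance : MeasurableSpace ℝ) := fun p =>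
    (h.measurable_seqIter p).comap_le
  have hanti : ∀ p, 𝓑 (p + 1) ≤ 𝓑 p := by
    rintro p _ ⟨B, hB, rfl⟩
    exact ⟨T (p + 1) ⁻¹' B, (h.qmp (p + 1) (by omega)).measurable hB, rfl⟩
  set X : ℕ → ℝ → ℝ := fun p => leb01[Z | 𝓑 p] with hX
  have hXi : ∀ p, Integrable (X p) leb01 := fun p => integrable_condExp
  have hclose : ∀ p, ∀ᵐ x ∂leb01, |X p x - tailMean T F p (seqIter T p x)| ≤ D₁ / n := fun p =>
    h.ae_abs_condExp_sub_tailMean_le hn hF p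
  have hX0 : X 0 = Z := by
    have h0 : 𝓑 0 = (inferInstance : MeasurableSpace ℝ) := MeasurableSpace.comap_id
    rw [hX]
    simp only [h0]
    exact condExp_of_stronglyMeasurable le_rfl hZm.stronglyMeasurable hZ
  set R := |F 0| + 1 with hR
  have hXR : ∀ p, ∀ᵐ x ∂leb01, |X p x| ≤ R := by
    intro p
    have hZR : ∀ᵐ x ∂leb01, |Z x| ≤ R := by
      filter_upwards [ae_mem_Icc] with x hx
      have h1 := hF.abs_sub_le hn (u := fun k => seqIter T k x) (v := 0) fun k _ =>
        abs_sub_le_one (mapsTo_seqIter h.mapsTo k hx) (by simp)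
      have := abs_sub_abs_le_abs_sub (Z x) (F 0)
      linarith
    refine ae_abs_condExp_le (hm p) hZ fun B _ => ?_
    rw [← Real.norm_eq_abs]
    refine norm_setIntegral_le_of_norm_le_const_ae (measure_lt_top _ _) ?_
    exact ae_restrict_of_ae hZR
  -- Triangle inequality behind `D`: from `X p` to its `tailMean`, on to the next one, and back to
  -- `X (p + 1)`.
  have hDn : D / n = D₁ / n + 1 / n + D₁ / n := by rw [hD]; ring
  have hDn0 : 0 ≤ D / n := by rw [hDn]; positivity
  have hstep : ∀ p, ∫ x, Real.exp (s * X p x) ∂leb01 ≤ Real.exp (s ^ 2 * (D / n) ^ 2 / 2) *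
      ∫ x, Real.exp (s * X (p + 1) x) ∂leb01 := by
    intro p
    have htower : leb01[X p | 𝓑 (p + 1)] =ᵐ[leb01] X (p + 1) :=
      condExp_condExp_of_le (hanti p) (hm p)
    have hd : ∀ᵐ x ∂leb01, |X p x - (leb01[X p | 𝓑 (p + 1)]) x| ≤ D / n := by
      filter_upwards [htower, hclose p, hclose (p + 1), ae_mem_Icc] with x h1 h2 h3 hx
      have h4 := h.abs_tailMean_sub_succ_le hn hF p hx
      rw [h1, hDn]
      rw [abs_sub_comm] at h3
      exact (abs_sub_le _ (tailMean T F p (seqIter T p x)) _).trans (by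
        have := abs_sub_le (tailMean T F p (seqIter T p x))
          (tailMean T F (p + 1) (seqIter T (p + 1) x)) (X (p + 1) x)
        linarith)
    refine (integral_exp_le_of_condExp (hm (p + 1)) (hXi p) (hXR p) hd s).trans
      (le_of_eq ?_)
    congr 1
    refine integral_congr_ae ?_
    filter_upwards [htower] with x hx
    rw [hx]
  have hchain : ∀ p, ∫ x, Real.exp (s * Z x) ∂leb01 ≤
      Real.exp (s ^ 2 * (D / n) ^ 2 / 2) ^ p * ∫ x, Real.exp (s * X p x) ∂leb01 := by
    intro p
    induction p with
    | zero => rw [hX0, pow_zero, one_mul]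
    | succ p ih =>
      refine ih.trans ?_
      rw [pow_succ _ p, mul_assoc]
      exact mul_le_mul_of_nonneg_left (hstep p) (by positivity)
  -- The last step conditions on the trivial σ-algebra. At time `n` no relevant coordinate is left
  -- in the future, so `tailMean` is the full mean.
  have hlast : ∫ x, Real.exp (s * X n x) ∂leb01 ≤ Real.exp (s ^ 2 * (D / n) ^ 2 / 2) *
      Real.exp (s * ∫ x, Z x ∂leb01) := by
    have hbot : leb01[X n | ⊥] = fun _ => ∫ x, Z x ∂leb01 := by
      rw [condExp_bot]
      funext _
      exact integral_condExp (hm n)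
    have hd : ∀ᵐ x ∂leb01, |X n x - (leb01[X n | ⊥]) x| ≤ D / n := by
      filter_upwards [hclose n] with x hx
      rw [tailMean_eq_integral hn hF] at hx
      rw [hbot, hDn]
      refine hx.trans ?_
      have : 0 ≤ D₁ / n := by positivity
      have : 0 ≤ 1 / (n : ℝ) := by positivity
      linarith
    have := integral_exp_le_of_condExp bot_le (hXi n) (hXR n) hd s
    rw [hbot] at this
    simpa using this
  refine (hchain n).trans ((mul_le_mul_of_nonneg_left hlast (by positivity)).trans ?_)
  rw [← mul_assoc, ← pow_succ, ← Real.exp_nat_mul]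
  gcongr
  have hn1 : (1 : ℝ) ≤ n := by exact_mod_cast hn
  push_cast
  -- There are `n + 1` steps in all; the target exponent lacks the factor `1/2`, which leaves room
  -- for `(n + 1) / (2 n) ≤ 1`.
  have h1 : ((n : ℝ) + 1) * (s ^ 2 * (D / n) ^ 2 / 2) =
      s ^ 2 * D ^ 2 / n * ((n + 1) / (2 * n)) := by field_simp
  rw [h1]
  refine mul_le_of_le_one_right (by positivity) ?_
  rw [div_le_one (by positivity)]
  linarith

end HasDecay

/-! ### Concentration of the shadowing distance -/

/-- The mean distance of a sequence to the orbits that start in `A`, up to time `n`. -/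
noncomputable def orbitDist (T : ℕ → ℝ → ℝ) (A : Set ℝ) (n : ℕ) (u : ℕ → ℝ) : ℝ :=
  ⨅ y : A, (1 / (n : ℝ)) * ∑ k ∈ Finset.range n, |u k - seqIter T k y|

theorem bddBelow_orbitDist (T : ℕ → ℝ → ℝ) (A : Set ℝ) (n : ℕ) (u : ℕ → ℝ) :
    BddBelow (range fun y : A => (1 / (n : ℝ)) * ∑ k ∈ Finset.range n, |u k - seqIter T k y|) := by
  refine ⟨0, ?_⟩
  rintro _ ⟨y, rfl⟩
  positivity

theorem isMeanLipschitz_orbitDist (T : ℕ → ℝ → ℝ) {A : Set ℝ} (hA : A.Nonempty) (n : ℕ) :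
    IsMeanLipschitz n (orbitDist T A n) := by
  have := hA.to_subtype
  have key : ∀ u v, orbitDist T A n u - (1 / (n : ℝ)) * ∑ k ∈ Finset.range n, |u k - v k| ≤
      orbitDist T A n v := by
    intro u v
    refine le_ciInf fun y => ?_
    have h1 := ciInf_le (bddBelow_orbitDist T A n u) y
    have h2 : (1 / (n : ℝ)) * ∑ k ∈ Finset.range n, |u k - seqIter T k y| ≤
        (1 / (n : ℝ)) * ∑ k ∈ Finset.range n, |u k - v k| +
          (1 / (n : ℝ)) * ∑ k ∈ Finset.range n, |v k - seqIter T k y| := by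
      rw [← mul_add, ← Finset.sum_add_distrib]
      gcongr with k _
      exact abs_sub_le _ _ _
    unfold orbitDist
    linarith
  intro u v
  refine abs_sub_le_iff.2 ⟨by linarith [key u v], ?_⟩
  have h1 := key v u
  simp_rw [abs_sub_comm (v _)] at h1
  linarith

theorem orbitDist_nonneg (T : ℕ → ℝ → ℝ) (A : Set ℝ) (n : ℕ) (u : ℕ → ℝ) :
    0 ≤ orbitDist T A n u :=
  Real.iInf_nonneg fun _ => by positivity

theorem orbitDist_eq_zero (T : ℕ → ℝ → ℝ) {A : Set ℝ} (n : ℕ) {x : ℝ} (hx : x ∈ A) :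
    orbitDist T A n (fun k => seqIter T k x) = 0 := by
  refine le_antisymm ?_ (orbitDist_nonneg _ _ _ _)
  refine (ciInf_le (bddBelow_orbitDist T A n _) ⟨x, hx⟩).trans (le_of_eq ?_)
  simp

theorem le_of_forall_exp_le {e V N L : ℝ} (hV : 0 < V) (hN : 0 < N)
    (H : ∀ s : ℝ, s * e ≤ s ^ 2 * V / N + L) (hL : 0 ≤ L) :
    e ≤ 2 * √V * (√L / √N) := by
  -- This value of `s` maximises `s e - s² V / N`, with maximum `e² N / (4 V)`.
  have h1 := H (e * N / (2 * V))
  have h2 : e ^ 2 ≤ 4 * V * L / N := by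
    have h3 : e * N / (2 * V) * e = e ^ 2 * (N / (2 * V)) := by ring
    have h4 : (e * N / (2 * V)) ^ 2 * V / N = e ^ 2 * (N / (4 * V)) := by field_simp; ring
    rw [h3, h4] at h1
    rw [le_div_iff₀ hN]
    have h5 : e ^ 2 * (N / (2 * V)) - e ^ 2 * (N / (4 * V)) = e ^ 2 * N / (4 * V) := by
      field_simp; ring
    have h6 : e ^ 2 * N / (4 * V) ≤ L := by linarith
    rw [div_le_iff₀ (by positivity)] at h6
    linarith
  refine abs_le_of_sq_le_sq' ?_ (by positivity) |>.2
  rw [mul_pow, mul_pow, div_pow, Real.sq_sqrt hV.le, Real.sq_sqrt hL, Real.sq_sqrt hN.le]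
  refine h2.trans (le_of_eq ?_)
  ring

theorem HasDecay.shadow_concentration {T : ℕ → ℝ → ℝ} {lam E θ : ℝ} (h : HasDecay T lam E θ) :
    ∃ C₁ C₂ : ℝ, 0 < C₁ ∧ 0 < C₂ ∧ ∀ A : Set ℝ, MeasurableSet A → 0 < leb01 A →
      ∀ n : ℕ, 1 ≤ n → ∀ t : ℝ, 0 < t →
        leb01.real {x | shadow T A n x >
            C₁ * (√|Real.log (leb01.real A)| / √n) + t / √n} ≤ Real.exp (-C₂ * t ^ 2) := by
  set D := 2 * (E * (2 + 2 * (lam / (lam - 1))) * (1 - θ)⁻¹ + 2) + 1 with hD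
  have hD0 : 0 < D := by
    have h1 := h.E_nonneg
    have h2 : 0 < lam - 1 := by linarith [h.one_lt]
    have h3 : 0 < lam := by linarith
    have h4 : 0 < 1 - θ := by linarith [h.θ_lt_one]
    positivity
  -- The first constant is that of `le_of_forall_exp_le` with `V = D²`; the second is the optimal
  -- Chernoff rate for the variance proxy `D²`.
  refine ⟨2 * √(D ^ 2), 1 / (4 * D ^ 2), by positivity, by positivity, ?_⟩
  intro A hA hA0 n hn t ht
  have hn' : (0 : ℝ) < n := by exact_mod_cast hn
  have hne : A.Nonempty := nonempty_of_measure_ne_zero hA0.ne'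
  have hF := isMeanLipschitz_orbitDist T hne n
  set Z : ℝ → ℝ := fun x => orbitDist T A n fun k => seqIter T k x with hZdef
  have hZm : Measurable Z := hF.continuous.measurable.comp
    (measurable_pi_lambda _ fun k => h.measurable_seqIter k)
  have hexp := h.integral_exp_orbit_le hn hF hD
  set e := ∫ x, Z x ∂leb01 with he
  have hZb : ∀ x ∈ Icc (0 : ℝ) 1, |Z x| ≤ |orbitDist T A n 0| + 1 := by
    intro x hx
    have h1 := hF.abs_sub_le hn (u := fun k => seqIter T k x) (v := 0) fun k _ =>
      abs_sub_le_one (mapsTo_seqIter h.mapsTo k hx) (by simp)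
    have := abs_sub_abs_le_abs_sub (Z x) (orbitDist T A n 0)
    linarith
  have hint : ∀ s : ℝ, Integrable (fun x => Real.exp (s * Z x)) leb01 := by
    intro s
    refine Integrable.of_bound (Real.measurable_exp.comp
      (hZm.const_mul s)).aestronglyMeasurable (Real.exp (|s| * (|orbitDist T A n 0| + 1))) ?_
    filter_upwards [ae_mem_Icc] with x hx
    rw [Real.norm_eq_abs, Real.abs_exp]
    refine Real.exp_le_exp.2 ((le_abs_self _).trans ?_)
    rw [abs_mul]
    gcongr
    exact hZb x hx
  have hA1 : leb01.real A ≤ 1 := measureReal_le_one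
  have hA0' : 0 < leb01.real A := ENNReal.toReal_pos hA0.ne' (measure_ne_top _ _)
  have hlog : |Real.log (leb01.real A)| = -Real.log (leb01.real A) :=
    abs_of_nonpos (Real.log_nonpos hA0'.le hA1)
  have hmean : e ≤ 2 * √(D ^ 2) * (√|Real.log (leb01.real A)| / √n) := by
    refine le_of_forall_exp_le (by positivity) hn' (fun s => ?_) (abs_nonneg _)
    -- `Z` vanishes on `A`, so the integrand equals `1` there.
    have h1 : leb01.real A ≤ ∫ x, Real.exp (-s * Z x) ∂leb01 := by
      have h2 : ∫ x in A, Real.exp (-s * Z x) ∂leb01 = leb01.real A := by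
        rw [setIntegral_congr_fun (g := fun _ => (1 : ℝ)) hA fun x hx => by
          simp [hZdef, orbitDist_eq_zero T n hx]]
        simp
      rw [← h2]
      exact setIntegral_le_integral (hint _) (Filter.Eventually.of_forall fun x =>
        (Real.exp_pos _).le)
    have h2 := h1.trans (hexp (-s))
    rw [← Real.exp_add] at h2
    have h3 := Real.log_le_log hA0' h2
    rw [Real.log_exp] at h3
    rw [hlog]
    have h4 : (-s) ^ 2 = s ^ 2 := by ring
    rw [h4] at h3
    linarith
  -- The minimiser of the Chernoff exponent `s² D² / n - s t / √n`, whose value there is `-t² / (4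
  -- D²)`.
  set s := t * √n / (2 * D ^ 2) with hs
  have hs0 : 0 < s := by positivity
  have hsub : {x | shadow T A n x > 2 * √(D ^ 2) * (√|Real.log (leb01.real A)| / √n) + t / √n} ⊆
      {x | Real.exp (s * (e + t / √n)) ≤ Real.exp (s * Z x)} := by
    intro x hx
    refine Real.exp_le_exp.2 (mul_le_mul_of_nonneg_left ?_ hs0.le)
    have hx' : Z x > 2 * √(D ^ 2) * (√|Real.log (leb01.real A)| / √n) + t / √n := hx
    linarith
  have hmarkov := mul_meas_ge_le_integral_of_nonneg
    (Filter.Eventually.of_forall fun x => (Real.exp_pos (s * Z x)).le) (hint s)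
    (Real.exp (s * (e + t / √n)))
  have h1 := (measureReal_mono (μ := leb01) hsub)
  have h2 := hmarkov.trans (hexp s)
  rw [← Real.exp_add, mul_comm, ← le_div_iff₀ (Real.exp_pos _), ← Real.exp_sub] at h2
  refine h1.trans (h2.trans (Real.exp_le_exp.2 (le_of_eq ?_)))
  have hsq : √(n : ℝ) ^ 2 = n := Real.sq_sqrt hn'.le
  have h3 : s ^ 2 * D ^ 2 / n = t ^ 2 / (4 * D ^ 2) := by
    rw [hs, div_pow, mul_pow, hsq]
    field_simp
    ring
  have h4 : s * (t / √n) = t ^ 2 / (2 * D ^ 2) := by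
    have : √(n : ℝ) ≠ 0 := (Real.sqrt_pos.2 hn').ne'
    rw [hs]
    field_simp
  rw [mul_add, h3, h4]
  field_simp
  ring

end SeqDyn

theorem mainTheorem5 (C : Set (ℝ → ℝ)) (hC : SeqDyn.IsAdmissibleClass C)
    (T : ℕ → ℝ → ℝ) (hT : ∀ n, 1 ≤ n → T n ∈ C) (hmin : SeqDyn.ConditionMin T) :
    ∃ C₁ C₂ : ℝ, 0 < C₁ ∧ 0 < C₂ ∧
      ∀ A : Set ℝ, MeasurableSet A → A ⊆ Set.Icc 0 1 → 0 < SeqDyn.leb01 A →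
        ∀ n : ℕ, 1 ≤ n → ∀ t : ℝ, 0 < t →
          SeqDyn.leb01.real {x | SeqDyn.shadow T A n x >
              C₁ * (Real.sqrt |Real.log (SeqDyn.leb01.real A)| / Real.sqrt n)
                + t / Real.sqrt n}
            ≤ Real.exp (-C₂ * t ^ 2) := by
  obtain ⟨lam, E, θ, h⟩ := SeqDyn.exists_hasDecay hC hT hmin
  obtain ⟨C₁, C₂, h1, h2, H⟩ := h.shadow_concentration
  exact ⟨C₁, C₂, h1, h2, fun A hA _ hA0 n hn t ht => H A hA hA0 n hn t ht⟩
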